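/- Let $\mathbb D$ be the space of càdlàg functions $y:[0,1]\to\mathbb R$, with norm $\|y\|=\sup_{s}|y(s)|$. Let $\Lambda$ be the set of strictly increasing continuous maps of $[0,1]$ onto itself, $e$ the identity, and $\|\lambda\|^0=\sup_{s<s'}\bigl|\log\frac{\lambda(s')-\lambda(s)}{s'-s}\bigr|$. Equip $\mathbb D$ with the $J_1$ distance $d^0_{J_1}(x,y)=\inf_{\lambda\in\Lambda}\{\|\lambda\|^0\vee\|x-y\circ\lambda\|\}$. Let $\mathbb D([0,1];\mathbb D)$ be the space of functions $x:[0,1]\to\mathbb D$ which are right-continuous with left limits with respect to $J_1$, with the distance $$d_{\mathbb D}(x,y)=\inf_{\lambda\in\Lambda}\Bigl\{\sup_{t}|\lambda(t)-t|\vee\sup_{t}d^0_{J_1}\bigl(x(t),y(\lambda(t))\bigr)\Bigr\},$$ its Borel $\sigma$-field $\mathcal D_{\mathbb D}$, and $\|x\|_{\mathbb D}=\sup_{t\in[0,1]}\|x(t)\|$. For $\delta\in(0,1)$ a finite set $0=t_0<t_1<\dots<t_v=1$ is called $\delta$-sparse if $\min_i(t_i-t_{i-1})>\delta$. For $y\in\mathbb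 D$ and $x\in\mathbb D([0,1];\mathbb D)$ let $$w'(y,\delta)=\inf_{\{t_i\}}\max_{1\le i\le v}\ \sup_{s,s'\in[t_{i-1},t_i)}|y(s)-y(s')|,\qquad w'_{\mathbb D}(x,\delta)=\inf_{\{t_i\}}\max_{1\le i\le v}\ \sup_{s,s'\in[t_{i-1},t_i)}d^0_{J_1}(x(s),x(s')),$$ the infima being over all $\delta$-sparse sets. Let $(P_n)_{n\ge1}$ be a sequence of probability measures on $(\mathbb D([0,1];\mathbb D),\mathcal D_{\mathbb D})$, each also denoting its outer extension (outer measure) on sets that need not be Borel, and let $T$ be any dense subset of $[0,1]$ with $1\in T$. Consider the conditions (i) $\lim_{a\to\infty}\limsup_{n\to\infty}P_n(\{x:\|x\|_{\mathbb D}\ge a\})=0$; (i') for each $t\in T$, $\lim_{a\to\infty}\limsup_{n\to\infty}P_n(\{x:\|x(t)\|\ge a\})=0$; (ii) for any $\varepsilon>0$, $\lim_{\delta\to0}\limsup_{n\to\infty}P_n(\{x: w'(x(t),\delta)\ge\varepsilon\text{ for some }t\in[0,1]\})=0$; (iii) for any $\varepsilon>0$, $\lim_{\delta\to0}\limsup_{n\to\infty}P_n(\{x: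 w'_{\mathbb D}(x,\delta)\ge\varepsilon\})=0$. Then (i), (ii), (iii) hold together if and only if (i'), (ii), (iii) hold together; and $(P_n)_{n\ge1}$ is tight (for every $\eta>0$ there is a $d_{\mathbb D}$-compact set $K$ with $P_n(K)\ge1-\eta$ for all $n$) if and only if (i'), (ii) and (iii) hold. -/

import Mathlib

open Filter Topology MeasureTheory
open scoped ENNReal unitInterval

namespace Skorokhod

/-- A function on `[0,1]` with values in a topological space is càdlàg if it is right-continuous
and has left limits. (At `t = 1` right-continuity is void, at `t = 0` the left limit is void.) -/
def IsCadlag {E : Type*} [TopologicalSpace E] (x : I → E) : Prop :=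
  (∀ t : I, ContinuousWithinAt x (Set.Ici t) t) ∧
    ∀ t : I, 0 < t → ∃ l : E, Tendsto x (𝓝[<] t) (𝓝 l)

/-! ### Time changes

The set `Λ` of strictly increasing continuous maps of `[0,1]` onto itself is the type `I ≃o I` of
order automorphisms of `[0,1]`: a strictly increasing surjection is an order isomorphism, and an
order isomorphism is automatically continuous. -/

/-- `‖l - e‖ = sup_t |l(t) - t|`. -/
noncomputable def uniformCost (l : I ≃o I) : ℝ≥0∞ := ⨆ t : I, edist (l t) t

/-- `‖l‖⁰ = sup_{s < s'} |log ((l(s') - l(s)) / (s' - s))|`, which may be `∞`. -/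
noncomputable def logSlopeCost (l : I ≃o I) : ℝ≥0∞ :=
  ⨆ (s : I) (s' : I) (_ : s < s'),
    ENNReal.ofReal |Real.log (((l s' : ℝ) - (l s : ℝ)) / ((s' : ℝ) - (s : ℝ)))|

/-- `inf_{l ∈ Λ} max (c(l), sup_t d(x(t), y(l(t))))`. -/
noncomputable def timeChangeEDist {E : Type*} [PseudoEMetricSpace E] (c : (I ≃o I) → ℝ≥0∞)
    (x y : I → E) : ℝ≥0∞ :=
  ⨅ l : I ≃o I, max (c l) (⨆ t : I, edist (x t) (y (l t)))

theorem uniformCost_refl : uniformCost (OrderIso.refl I) = 0 := by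
  simp [uniformCost]

theorem uniformCost_symm (l : I ≃o I) : uniformCost l.symm ≤ uniformCost l := by
  refine iSup_le fun t => ?_
  have h : edist (l (l.symm t)) (l.symm t) ≤ uniformCost l :=
    le_iSup (fun t : I => edist (l t) t) (l.symm t)
  rwa [l.apply_symm_apply, edist_comm] at h

theorem uniformCost_trans (l m : I ≃o I) :
    uniformCost (l.trans m) ≤ uniformCost l + uniformCost m := by
  refine iSup_le fun t => ?_
  refine (edist_triangle (m (l t)) (l t) t).trans ?_
  rw [add_comm]
  exact add_le_add (le_iSup (fun t : I => edist (l t) t) t)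
    (le_iSup (fun t : I => edist (m t) t) (l t))

theorem le_logSlopeCost (l : I ≃o I) {s s' : I} (h : s < s') :
    ENNReal.ofReal |Real.log (((l s' : ℝ) - (l s : ℝ)) / ((s' : ℝ) - (s : ℝ)))| ≤
      logSlopeCost l :=
  le_iSup_of_le s (le_iSup_of_le s' (le_iSup_of_le h le_rfl))

theorem logSlopeCost_refl : logSlopeCost (OrderIso.refl I) = 0 := by
  refine le_antisymm (iSup_le fun s => iSup_le fun s' => iSup_le fun h => ?_) bot_le
  have h' : ((s' : ℝ) - (s : ℝ)) ≠ 0 := (sub_pos.2 (show (s : ℝ) < s' from h)).ne'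
  simp [div_self h']

theorem logSlopeCost_symm (l : I ≃o I) : logSlopeCost l.symm ≤ logSlopeCost l := by
  refine iSup_le fun s => iSup_le fun s' => iSup_le fun h => ?_
  have key := le_logSlopeCost l (l.symm.strictMono h)
  rw [l.apply_symm_apply, l.apply_symm_apply] at key
  refine le_trans (le_of_eq ?_) key
  rw [← inv_div, Real.log_inv, abs_neg]

theorem logSlopeCost_trans (l m : I ≃o I) :
    logSlopeCost (l.trans m) ≤ logSlopeCost l + logSlopeCost m := by
  refine iSup_le fun s => iSup_le fun s' => iSup_le fun h => ?_
  refine le_trans ?_ (add_le_add (le_logSlopeCost l h) (le_logSlopeCost m (l.strictMono h)))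
  rw [← ENNReal.ofReal_add (abs_nonneg _) (abs_nonneg _)]
  refine ENNReal.ofReal_le_ofReal ?_
  have h1 : 0 < (s' : ℝ) - (s : ℝ) := sub_pos.2 h
  have h2 : 0 < (l s' : ℝ) - (l s : ℝ) := sub_pos.2 (l.strictMono h)
  have h3 : 0 < (m (l s') : ℝ) - (m (l s) : ℝ) := sub_pos.2 (m.strictMono (l.strictMono h))
  simp only [OrderIso.trans_apply]
  rw [Real.log_div h3.ne' h1.ne', Real.log_div h3.ne' h2.ne', Real.log_div h2.ne' h1.ne']
  refine le_trans (le_of_eq ?_) (abs_add_le _ _)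
  congr 1
  ring

section TimeChange

variable {E : Type*} [PseudoEMetricSpace E]

theorem timeChangeEDist_self {c : (I ≃o I) → ℝ≥0∞} (hc : c (OrderIso.refl I) = 0) (x : I → E) :
    timeChangeEDist c x x = 0 := by
  refine le_antisymm (iInf_le_of_le (OrderIso.refl I) ?_) bot_le
  simp [hc]

theorem timeChangeEDist_le_comm {c : (I ≃o I) → ℝ≥0∞} (hc : ∀ l, c l.symm ≤ c l) (x y : I → E) :
    timeChangeEDist c y x ≤ timeChangeEDist c x y := by
  refine le_iInf fun l => iInf_le_of_le l.symm (max_le_max (hc l) (iSup_le fun t => ?_))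
  have h := le_iSup (fun t : I => edist (x t) (y (l t))) (l.symm t)
  simpa [edist_comm] using h

theorem timeChangeEDist_triangle {c : (I ≃o I) → ℝ≥0∞}
    (hc : ∀ l m : I ≃o I, c (l.trans m) ≤ c l + c m) (x y z : I → E) :
    timeChangeEDist c x z ≤ timeChangeEDist c x y + timeChangeEDist c y z := by
  refine ENNReal.le_iInf_add_iInf fun l m => iInf_le_of_le (l.trans m) ?_
  refine max_le ((hc l m).trans (add_le_add (le_max_left _ _) (le_max_left _ _)))
    (iSup_le fun t => ?_)
  refine (edist_triangle (x t) (y (l t)) (z (m (l t)))).trans (add_le_add ?_ ?_)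
  · exact (le_iSup (fun t : I => edist (x t) (y (l t))) t).trans (le_max_right _ _)
  · exact (le_iSup (fun t : I => edist (y t) (z (m t))) (l t)).trans (le_max_right _ _)

end TimeChange

/-! ### The Skorokhod space `𝔻` of real-valued càdlàg functions -/

/-- The space `𝔻` of càdlàg functions `[0,1] → ℝ`. -/
structure D where
  toFun : I → ℝ
  cadlag : IsCadlag toFun

instance : CoeFun D fun _ => I → ℝ := ⟨D.toFun⟩

/-- `𝔻` carries the distance `d⁰(x,y) = inf_l max (‖l‖⁰, ‖x - y ∘ l‖)`, whose topology is the
`J₁` topology. -/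
noncomputable instance : PseudoEMetricSpace D where
  edist x y := timeChangeEDist logSlopeCost x y
  edist_self x := timeChangeEDist_self logSlopeCost_refl x
  edist_comm x y := le_antisymm (timeChangeEDist_le_comm logSlopeCost_symm y x)
    (timeChangeEDist_le_comm logSlopeCost_symm x y)
  edist_triangle x y z := timeChangeEDist_triangle logSlopeCost_trans x y z

/-- The uniform norm `‖x‖ = sup_s |x(s)|` on `𝔻`. -/
noncomputable def D.supNorm (x : D) : ℝ≥0∞ := ⨆ s : I, ‖x s‖ₑ

/-! ### The space `𝔻([0,1]; 𝔻)` -/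

/-- The space `𝔻([0,1]; 𝔻)` of functions `[0,1] → 𝔻` which are càdlàg with respect to `J₁`. -/
structure DD where
  toFun : I → D
  cadlag : IsCadlag toFun

instance : CoeFun DD fun _ => I → D := ⟨DD.toFun⟩

/-- `𝔻([0,1]; 𝔻)` carries the distance
`inf_l max (‖l - e‖, sup_t d⁰(x(t), y(l(t))))` and its topology. -/
noncomputable instance : PseudoEMetricSpace DD where
  edist x y := timeChangeEDist uniformCost x y
  edist_self x := timeChangeEDist_self uniformCost_refl x
  edist_comm x y := le_antisymm (timeChangeEDist_le_comm uniformCost_symm y x)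
    (timeChangeEDist_le_comm uniformCost_symm x y)
  edist_triangle x y z := timeChangeEDist_triangle uniformCost_trans x y z

noncomputable instance : MeasurableSpace DD := borel DD

instance : BorelSpace DD := ⟨rfl⟩

/-- The super-uniform norm `sup_t ‖x(t)‖` on `𝔻([0,1]; 𝔻)`. -/
noncomputable def DD.supNorm (x : DD) : ℝ≥0∞ := ⨆ t : I, (x t).supNorm

/-! ### Moduli of continuity -/

section Modulus

variable {E : Type*} [PseudoEMetricSpace E]

/-- The oscillation `w(x,T) = sup_{s,t ∈ T} d(x(s), x(t))`. -/
noncomputable def osc (x : I → E) (T : Set I) : ℝ≥0∞ :=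
  ⨆ s ∈ T, ⨆ t ∈ T, edist (x s) (x t)

/-- `0 = t₀ < t₁ < ... < t_v = 1` is `δ`-sparse if `t_i - t_{i-1} > δ` for all `i = 1, ..., v`. -/
structure IsSparse (δ : ℝ) {v : ℕ} (t : Fin (v + 1) → I) : Prop where
  first : t 0 = 0
  last : t (Fin.last v) = 1
  strictMono : StrictMono t
  gap : ∀ i : Fin v, δ < (t i.succ : ℝ) - (t i.castSucc : ℝ)

/-- The modulus `w'(x,δ)`: the infimum over all `δ`-sparse sets of
`max_i w(x, [t_{i-1}, t_i))`. -/
noncomputable def modulus (x : I → E) (δ : ℝ) : ℝ≥0∞ :=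
  ⨅ (v : ℕ) (t : Fin (v + 1) → I) (_ : IsSparse δ t),
    ⨆ i : Fin v, osc x (Set.Ico (t i.castSucc) (t i.succ))

end Modulus

/-! ### The conditions on a sequence of measures on `𝔻([0,1]; 𝔻)` -/

/-- Condition (i): `lim_{a → ∞} limsup_n P_n {x : ‖x‖_𝔻 ≥ a} = 0`. -/
def CondNorm (P : ℕ → Measure DD) : Prop :=
  Tendsto (fun a : ℝ => limsup (fun n => P n {x | ENNReal.ofReal a ≤ x.supNorm}) atTop)
    atTop (𝓝 0)

/-- Condition (i'): for each `t ∈ T`, `lim_{a → ∞} limsup_n P_n {x : ‖x(t)‖ ≥ a} = 0`. -/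
def CondNormAt (P : ℕ → Measure DD) (T : Set I) : Prop :=
  ∀ t ∈ T, Tendsto
    (fun a : ℝ => limsup (fun n => P n {x | ENNReal.ofReal a ≤ (x t).supNorm}) atTop)
    atTop (𝓝 0)

/-- Condition (ii): for each `ε > 0`,
`lim_{δ → 0} limsup_n P_n {x : w'(x(t),δ) ≥ ε for some t} = 0`. -/
def CondSpaceModulus (P : ℕ → Measure DD) : Prop :=
  ∀ ε : ℝ, 0 < ε → Tendsto
    (fun δ : ℝ =>
      limsup (fun n => P n {x | ∃ t : I, ENNReal.ofReal ε ≤ modulus (x t) δ}) atTop)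
    (𝓝[>] 0) (𝓝 0)

/-- Condition (iii): for each `ε > 0`, `lim_{δ → 0} limsup_n P_n {x : w'_𝔻(x,δ) ≥ ε} = 0`. -/
def CondTimeModulus (P : ℕ → Measure DD) : Prop :=
  ∀ ε : ℝ, 0 < ε → Tendsto
    (fun δ : ℝ => limsup (fun n => P n {x | ENNReal.ofReal ε ≤ modulus x δ}) atTop)
    (𝓝[>] 0) (𝓝 0)

end Skorokhod

namespace Skorokhod

/-! ### Time changes with bounded slopes -/

/-! Sufficiency is Arzelà–Ascoli used twice. Càdlàg maps with values in a totally bounded subset of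
`E` and uniformly small moduli form a totally bounded set (`CadlagMap.totallyBounded`): a cheap time
change moves the partition points onto a grid, which leaves finitely many step functions. `E = ℝ`
treats the functions x(t), and `E = 𝔻` treats x itself. The log-slope cost makes the càdlàg maps
complete when `E` is (`CadlagMap.exists_limit`), so total boundedness yields compactness. The
distance of `DD`, with its uniform cost, is not complete; compact sets reach it through the
continuous map `DD.ofCadlagMap`.

The bad sets in (i), (ii), (iii) are all `LocallyVanishing`. A compact set eventually misses them,
which gives necessity. Each single finite measure of them tends to 0, so a limsup condition improves
to a bound for every n; a countable union of small bad sets then has complement inside a compact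
set.

Finally (i') and (iii) imply (i): every cell of a sparse partition contains one of finitely many
points of `T`, and x varies little on a cell (`CondNormAt.condNorm`). -/

theorem logSlopeCost_le_iff (l : I ≃o I) {c : ℝ} (hc : 0 ≤ c) :
    logSlopeCost l ≤ ENNReal.ofReal c ↔ ∀ s s' : I, s < s' →
      Real.exp (-c) * ((s' : ℝ) - s) ≤ (l s' : ℝ) - l s ∧
        (l s' : ℝ) - l s ≤ Real.exp c * ((s' : ℝ) - s) := by
  simp only [logSlopeCost, iSup_le_iff]
  refine forall_congr' fun s => forall_congr' fun s' => forall_congr' fun h => ?_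
  have h1 : 0 < (s' : ℝ) - s := sub_pos.2 h
  have h2 : 0 < (l s' : ℝ) - l s := sub_pos.2 (l.strictMono h)
  rw [ENNReal.ofReal_le_ofReal_iff hc, abs_le, Real.le_log_iff_exp_le (div_pos h2 h1),
    Real.log_le_iff_le_exp (div_pos h2 h1), le_div_iff₀ h1, div_le_iff₀ h1]

/-- Since `l` fixes 0, the slope between 0 and `t` controls the displacement; the factor 2 comes
from exp c ≤ 1 + 2c on [0,1]. -/
theorem dist_le_of_logSlopeCost_le {l : I ≃o I} {c : ℝ} (hc : 0 ≤ c) (hc1 : c ≤ 1)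
    (h : logSlopeCost l ≤ ENNReal.ofReal c) (t : I) : dist (l t) t ≤ 2 * c := by
  rcases eq_or_lt_of_le (show 0 ≤ t from t.2.1) with rfl | ht
  · have : l 0 = 0 := l.map_bot
    simp [this, hc]
  have h0 : l 0 = 0 := l.map_bot
  obtain ⟨h1, h2⟩ := (logSlopeCost_le_iff l hc).1 h 0 t ht
  simp only [h0, Set.Icc.coe_zero, sub_zero] at h1 h2
  have t0 : (0 : ℝ) ≤ t := t.2.1
  have t1 : (t : ℝ) ≤ 1 := t.2.2
  have e1 : 1 - c ≤ Real.exp (-c) := by linarith [Real.add_one_le_exp (-c)]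
  have e2 : Real.exp c ≤ 1 + 2 * c := by
    have := Real.abs_exp_sub_one_le (x := c) (by rwa [abs_of_nonneg hc])
    rw [abs_of_nonneg hc] at this
    linarith [le_abs_self (Real.exp c - 1)]
  rw [Subtype.dist_eq, Real.dist_eq, abs_le]
  constructor <;> nlinarith

theorem uniformCost_le_of_logSlopeCost_le {l : I ≃o I} {c : ℝ} (hc : 0 ≤ c) (hc1 : c ≤ 1)
    (h : logSlopeCost l ≤ ENNReal.ofReal c) : uniformCost l ≤ ENNReal.ofReal (2 * c) :=
  iSup_le fun t => by
    rw [edist_dist]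
    exact ENNReal.ofReal_le_ofReal (dist_le_of_logSlopeCost_le hc hc1 h t)

/-- A self-map of `[0,1]` fixing the endpoints with slopes in `[exp (-c), exp c]` is a time
change. -/
theorem exists_orderIso_of_slope {f : I → I} (f0 : f 0 = 0) (f1 : f 1 = 1) {c : ℝ} (hc : 0 ≤ c)
    (h : ∀ s s' : I, s < s' → Real.exp (-c) * ((s' : ℝ) - s) ≤ (f s' : ℝ) - f s ∧
      (f s' : ℝ) - f s ≤ Real.exp c * ((s' : ℝ) - s)) :
    ∃ l : I ≃o I, (∀ s, l s = f s) ∧ logSlopeCost l ≤ ENNReal.ofReal c := by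
  have hmono : StrictMono f := fun s s' hs => by
    have h1 : 0 < (s' : ℝ) - s := sub_pos.2 hs
    have := (h s s' hs).1
    have h2 : 0 < Real.exp (-c) * ((s' : ℝ) - s) := by positivity
    exact Subtype.coe_lt_coe.1 (by linarith)
  have hcont : Continuous f := by
    refine (LipschitzWith.of_dist_le_mul (K := (Real.exp c).toNNReal) fun s s' => ?_).continuous
    rw [Real.coe_toNNReal _ (Real.exp_pos c).le]
    have key : ∀ s s' : I, s < s' → dist (f s) (f s') ≤ Real.exp c * dist s s' := by
      intro s s' hs
      have h1 : 0 < (s' : ℝ) - s := sub_pos.2 hs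
      have h2 : 0 < (f s' : ℝ) - f s := sub_pos.2 (hmono hs)
      rw [dist_comm, dist_comm s, Subtype.dist_eq, Subtype.dist_eq, Real.dist_eq, Real.dist_eq,
        abs_of_pos h1, abs_of_pos h2]
      exact (h s s' hs).2
    rcases lt_trichotomy s s' with hs | rfl | hs
    · exact key s s' hs
    · simp
    · rw [dist_comm, dist_comm s]
      exact key s' s hs
  have hsurj : Function.Surjective f := fun y => by
    have := intermediate_value_univ 0 1 hcont
    rw [f0, f1] at this
    exact this ⟨y.2.1, y.2.2⟩
  refine ⟨hmono.orderIsoOfSurjective f hsurj, fun s => rfl, ?_⟩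
  exact (logSlopeCost_le_iff _ hc).2 h

/-- A map which is close to the identity on a set, in the sense that its displacement is
`ε`-Lipschitz there, agrees on this set with a time change of small cost. -/
theorem exists_orderIso_eqOn {S : Set I} (h0 : 0 ∈ S) (h1 : 1 ∈ S) {g : I → I} (g0 : g 0 = 0)
    (g1 : g 1 = 1) {ε : ℝ} (hε : 0 ≤ ε) (hε' : ε ≤ 1 / 2)
    (h : ∀ s ∈ S, ∀ t ∈ S, |((g s : ℝ) - s) - ((g t : ℝ) - t)| ≤ ε * |(s : ℝ) - t|) :
    ∃ l : I ≃o I, (∀ s ∈ S, l s = g s) ∧ logSlopeCost l ≤ ENNReal.ofReal (2 * ε) := by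
  -- The displacement, not `g`, is extended from `S`: adding back the identity then gives slopes in
  -- [1 - ε, 1 + ε].
  have hL : LipschitzOnWith ε.toNNReal (fun s : I => (g s : ℝ) - s) S :=
    LipschitzOnWith.of_dist_le_mul fun s hs t ht => by
      rw [Real.coe_toNNReal _ hε, Real.dist_eq, Subtype.dist_eq, Real.dist_eq]
      exact h s hs t ht
  obtain ⟨G, hG, hGS⟩ := hL.extend_real
  have hG' : ∀ s t : I, |G s - G t| ≤ ε * |(s : ℝ) - t| := fun s t => by
    have := hG.dist_le_mul s t
    rwa [Real.coe_toNNReal _ hε, Real.dist_eq, Subtype.dist_eq, Real.dist_eq] at this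
  have G0 : G 0 = 0 := by rw [← hGS h0]; simp [g0]
  have G1 : G 1 = 0 := by rw [← hGS h1]; simp [g1]
  have hmem : ∀ s : I, (s : ℝ) + G s ∈ Set.Icc (0 : ℝ) 1 := fun s => by
    have s0 : (0 : ℝ) ≤ s := s.2.1
    have s1 : (s : ℝ) ≤ 1 := s.2.2
    have a := hG' s 0
    have b := hG' s 1
    rw [G0, Set.Icc.coe_zero, sub_zero, sub_zero, abs_of_nonneg s0] at a
    rw [G1, Set.Icc.coe_one, sub_zero, abs_of_nonpos (by linarith : (s : ℝ) - 1 ≤ 0)] at b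
    constructor
    · nlinarith [(abs_le.1 a).1]
    · nlinarith [(abs_le.1 b).2]
  obtain ⟨l, hl, hlc⟩ := exists_orderIso_of_slope (f := fun s => ⟨s + G s, hmem s⟩)
    (by ext; simp [G0]) (by ext; simp [G1]) (c := 2 * ε) (by positivity) fun s s' hs => by
      have hpos : 0 < (s' : ℝ) - s := sub_pos.2 hs
      have a := hG' s' s
      rw [abs_of_pos hpos, abs_le] at a
      have e2 : 1 + ε ≤ Real.exp (2 * ε) := by linarith [Real.add_one_le_exp (2 * ε)]
      -- Uses (1 - ε)(1 + 2ε) ≥ 1, which is where ε ≤ 1/2 enters.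
      have e1 : Real.exp (-(2 * ε)) ≤ 1 - ε := by
        rw [Real.exp_neg, inv_le_comm₀ (Real.exp_pos _) (by linarith)]
        refine le_trans ?_ (Real.add_one_le_exp (2 * ε))
        rw [inv_le_iff_one_le_mul₀ (by linarith)]
        nlinarith
      constructor
      · have := mul_le_mul_of_nonneg_right e1 hpos.le
        simp only
        linarith [a.1]
      · have := mul_le_mul_of_nonneg_right e2 hpos.le
        simp only
        linarith [a.2]
  refine ⟨l, fun s hs => ?_, hlc⟩
  rw [hl]
  ext
  have := hGS hs
  simp only at this ⊢
  linarith

theorem timeChangeEDist_lt_iff {E : Type*} [PseudoEMetricSpace E] {c : (I ≃o I) → ℝ≥0∞}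
    {x y : I → E} {r : ℝ≥0∞} :
    timeChangeEDist c x y < r ↔ ∃ l : I ≃o I, c l < r ∧ ⨆ t, edist (x t) (y (l t)) < r := by
  simp [timeChangeEDist, iInf_lt_iff]

theorem timeChangeEDist_le {E : Type*} [PseudoEMetricSpace E] {c : (I ≃o I) → ℝ≥0∞}
    {x y : I → E} {r : ℝ≥0∞} (l : I ≃o I) (h1 : c l ≤ r) (h2 : ∀ t, edist (x t) (y (l t)) ≤ r) :
    timeChangeEDist c x y ≤ r :=
  iInf_le_of_le l (max_le h1 (iSup_le h2))

/-! ### Càdlàg functions -/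

section Cadlag

variable {E : Type*}

theorem IsCadlag.comp_orderIso [TopologicalSpace E] {x : I → E} (hx : IsCadlag x) (l : I ≃o I) :
    IsCadlag (x ∘ l) := by
  refine ⟨fun t => ?_, fun t ht => ?_⟩
  · exact (hx.1 (l t)).comp l.continuous.continuousWithinAt fun s hs => l.monotone hs
  · have h0 : 0 < l t := by
      have := l.strictMono ht
      rwa [show l 0 = 0 from l.map_bot] at this
    obtain ⟨a, ha⟩ := hx.2 (l t) h0
    refine ⟨a, ha.comp ?_⟩
    exact tendsto_nhdsWithin_of_tendsto_nhds_of_eventually_within _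
      (l.continuous.continuousAt.tendsto.mono_left nhdsWithin_le_nhds)
      (eventually_mem_nhdsWithin.mono fun s hs => l.strictMono hs)

theorem nhdsLT_neBot_of_pos {t : I} (ht : 0 < t) : (𝓝[<] t).NeBot :=
  nhdsLT_neBot_of_exists_lt ⟨0, ht⟩

theorem isCadlag_of_uniform_approx [PseudoEMetricSpace E] [CompleteSpace E] {y : I → E}
    (h : ∀ ε : ℝ≥0∞, 0 < ε → ∃ z : I → E, IsCadlag z ∧ ∀ t, edist (z t) (y t) ≤ ε) :
    IsCadlag y := by
  refine ⟨fun t => ?_, fun t ht => ?_⟩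
  · rw [ContinuousWithinAt, EMetric.tendsto_nhds]
    intro ε hε
    obtain ⟨η, hη, hηε⟩ := exists_between hε
    have hη3 : 0 < η / 3 := ENNReal.div_pos hη.ne' (by simp)
    obtain ⟨z, hz, hzy⟩ := h (η / 3) hη3
    filter_upwards [EMetric.tendsto_nhds.1 (hz.1 t) (η / 3) hη3] with s hs
    calc edist (y s) (y t) ≤ edist (y s) (z s) + edist (z s) (z t) + edist (z t) (y t) :=
          edist_triangle4 _ _ _ _
      _ ≤ η / 3 + η / 3 + η / 3 := by
          gcongr
          · rw [edist_comm]; exact hzy s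
          · exact hzy t
      _ = η := ENNReal.add_thirds η
      _ < ε := hηε
  · have := nhdsLT_neBot_of_pos ht
    -- Only the Cauchy property is transferred from the approximants, so their left limits need not
    -- be compared with each other.
    suffices hC : Cauchy (map y (𝓝[<] t)) from CompleteSpace.complete hC
    refine EMetric.cauchy_iff.2 ⟨(inferInstance : (map y (𝓝[<] t)).NeBot).ne, fun ε hε => ?_⟩
    obtain ⟨η, hη, hηε⟩ := exists_between hε
    have hη4 : 0 < η / 2 / 2 :=
      ENNReal.div_pos (ENNReal.div_pos hη.ne' (by simp)).ne' (by simp)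
    obtain ⟨z, hz, hzy⟩ := h (η / 2 / 2) hη4
    obtain ⟨a, ha⟩ := hz.2 t ht
    refine ⟨_, image_mem_map (EMetric.tendsto_nhds.1 ha (η / 2 / 2) hη4), ?_⟩
    have key : ∀ s, edist (z s) a < η / 2 / 2 → edist (y s) a ≤ η / 2 := fun s hs =>
      calc edist (y s) a ≤ edist (y s) (z s) + edist (z s) a := edist_triangle _ _ _
        _ ≤ η / 2 / 2 + η / 2 / 2 := by
            gcongr
            rw [edist_comm]; exact hzy s
        _ = η / 2 := ENNReal.add_halves _
    rintro _ ⟨s, hs, rfl⟩ _ ⟨s', hs', rfl⟩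
    calc edist (y s) (y s') ≤ edist (y s) a + edist (y s') a := edist_triangle_right _ _ _
      _ ≤ η / 2 + η / 2 := add_le_add (key s hs) (key s' hs')
      _ = η := ENNReal.add_halves _
      _ < ε := hηε

/-- A function depending only on the grid cell `⌊N s⌋` is càdlàg. -/
theorem isCadlag_step [TopologicalSpace E] {N : ℕ} (hN : 0 < N) (p : ℕ → E) :
    IsCadlag fun s : I => p ⌊(N : ℝ) * s⌋₊ := by
  have hN' : (0 : ℝ) < N := by exact_mod_cast hN
  have hc : Continuous fun s : I => (N : ℝ) * s := by fun_prop
  simp only [← Int.floor_toNat]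
  -- The integer floor is eventually constant on each side of a point, equal to ⌈Nt⌉ - 1 on the
  -- left.
  refine ⟨fun t => ?_, fun t _ => ⟨p (⌈(N : ℝ) * t⌉ - 1).toNat, ?_⟩⟩
  · have h : Tendsto (fun s : I => (N : ℝ) * s) (𝓝[≥] t) (𝓝[≥] ((N : ℝ) * t)) :=
      tendsto_nhdsWithin_of_tendsto_nhds_of_eventually_within _
        (hc.continuousAt.tendsto.mono_left nhdsWithin_le_nhds)
        (eventually_mem_nhdsWithin.mono fun s hs =>
          mul_le_mul_of_nonneg_left (show (t : ℝ) ≤ s from hs) hN'.le)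
    exact ((tendsto_pure_pure (fun z : ℤ => p z.toNat) _).comp
      ((tendsto_floor_right_pure_floor _).comp h)).mono_right (pure_le_nhds _)
  · have h : Tendsto (fun s : I => (N : ℝ) * s) (𝓝[<] t) (𝓝[<] ((N : ℝ) * t)) :=
      tendsto_nhdsWithin_of_tendsto_nhds_of_eventually_within _
        (hc.continuousAt.tendsto.mono_left nhdsWithin_le_nhds)
        (eventually_mem_nhdsWithin.mono fun s hs =>
          mul_lt_mul_of_pos_left (show (s : ℝ) < t from hs) hN')
    exact ((tendsto_pure_pure (fun z : ℤ => p z.toNat) _).comp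
      ((tendsto_floor_left_pure_ceil_sub_one _).comp h)).mono_right (pure_le_nhds _)

end Cadlag

/-! ### The complete Skorokhod distance on càdlàg functions with values in `E` -/

/-- The space `𝔻([0,1]; E)` of càdlàg functions with values in `E`. -/
structure CadlagMap (E : Type*) [TopologicalSpace E] where
  toFun : I → E
  cadlag : IsCadlag toFun

/-- `𝔻([0,1]; E)` carries the distance `inf_l max (‖l‖⁰, sup_t d(x(t), y(l(t))))`. -/
noncomputable instance {E : Type*} [PseudoEMetricSpace E] : PseudoEMetricSpace (CadlagMap E) where
  edist x y := timeChangeEDist logSlopeCost x.toFun y.toFun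
  edist_self x := timeChangeEDist_self logSlopeCost_refl x.toFun
  edist_comm x y := le_antisymm (timeChangeEDist_le_comm logSlopeCost_symm y.toFun x.toFun)
    (timeChangeEDist_le_comm logSlopeCost_symm x.toFun y.toFun)
  edist_triangle x y z := timeChangeEDist_triangle logSlopeCost_trans x.toFun y.toFun z.toFun

/-- The composition `l_{n-1} ∘ ... ∘ l_0`. -/
noncomputable def iterComp (l : ℕ → I ≃o I) : ℕ → I ≃o I
  | 0 => OrderIso.refl I
  | n + 1 => (iterComp l n).trans (l n)

/-- Exact partial sums of the geometric series, so that the induction on accumulated costs closes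
without loss. -/
theorem half_pow_sum (n k : ℕ) :
    ENNReal.ofReal ((1 / 2 : ℝ) ^ n * (1 - (1 / 2) ^ k)) + ENNReal.ofReal ((1 / 2 : ℝ) ^ (n + k + 1))
      = ENNReal.ofReal ((1 / 2 : ℝ) ^ n * (1 - (1 / 2) ^ (k + 1))) := by
  have : (1 / 2 : ℝ) ^ k ≤ 1 := pow_le_one₀ (by norm_num) (by norm_num)
  rw [← ENNReal.ofReal_add (mul_nonneg (by positivity) (by linarith)) (by positivity)]
  congr 1
  ring

variable {l : ℕ → I ≃o I}

theorem logSlopeCost_iterComp_aux (hl : ∀ n, logSlopeCost (l n) ≤ ENNReal.ofReal ((1 / 2) ^ (n + 1)))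
    (n k : ℕ) : logSlopeCost ((iterComp l n).symm.trans (iterComp l (n + k))) ≤
      ENNReal.ofReal ((1 / 2) ^ n * (1 - (1 / 2) ^ k)) := by
  induction k with
  | zero =>
    simp [logSlopeCost_refl]
  | succ k ih =>
    have : (iterComp l n).symm.trans (iterComp l (n + (k + 1))) =
        ((iterComp l n).symm.trans (iterComp l (n + k))).trans (l (n + k)) := by
      ext; rfl
    rw [this, ← half_pow_sum]
    exact (logSlopeCost_trans _ _).trans (add_le_add ih (hl _))

theorem logSlopeCost_iterComp (hl : ∀ n, logSlopeCost (l n) ≤ ENNReal.ofReal ((1 / 2) ^ (n + 1)))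
    {n m : ℕ} (h : n ≤ m) : logSlopeCost ((iterComp l n).symm.trans (iterComp l m)) ≤
      ENNReal.ofReal ((1 / 2) ^ n) := by
  obtain ⟨k, rfl⟩ := Nat.exists_eq_add_of_le h
  refine (logSlopeCost_iterComp_aux hl n k).trans (ENNReal.ofReal_le_ofReal ?_)
  have : (0 : ℝ) ≤ (1 / 2) ^ n * (1 / 2) ^ k := by positivity
  linarith

/-- Infinite compositions of time changes with summable costs converge. -/
theorem exists_limit_iterComp
    (hl : ∀ n, logSlopeCost (l n) ≤ ENNReal.ofReal ((1 / 2) ^ (n + 1))) :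
    ∃ L : I ≃o I, ∀ n, logSlopeCost ((iterComp l n).symm.trans L) ≤
      ENNReal.ofReal ((1 / 2) ^ n) := by
  have hcau : ∀ t, ∃ a, Tendsto (fun n => iterComp l n t) atTop (𝓝 a) := fun t => by
    refine cauchySeq_tendsto_of_complete (cauchySeq_of_le_geometric_two (C := 2) fun n => ?_)
    have := dist_le_of_logSlopeCost_le (by positivity)
      (pow_le_one₀ (by norm_num) (by norm_num)) (hl n) (iterComp l n t)
    rw [dist_comm]
    refine this.trans (le_of_eq ?_)
    rw [pow_succ, one_div, inv_pow]
    ring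
  choose f hf using hcau
  -- Two-sided slope bounds survive pointwise limits. The case n = 0 makes the limit a time change;
  -- general n gives the rate of convergence.
  have hslope : ∀ n (s s' : I), s < s' →
      Real.exp (-(1 / 2) ^ n) * ((s' : ℝ) - s) ≤
        (f ((iterComp l n).symm s') : ℝ) - f ((iterComp l n).symm s) ∧
      (f ((iterComp l n).symm s') : ℝ) - f ((iterComp l n).symm s) ≤
        Real.exp ((1 / 2) ^ n) * ((s' : ℝ) - s) := by
    intro n s s' hs
    have hb : ∀ᶠ m in atTop, _ := (eventually_ge_atTop n).mono fun m hm =>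
      (logSlopeCost_le_iff _ (by positivity)).1 (logSlopeCost_iterComp hl hm) s s' hs
    have ht : ∀ u, Tendsto (fun m => (iterComp l m u : ℝ)) atTop (𝓝 (f u)) := fun u =>
      (continuous_subtype_val.tendsto _).comp (hf u)
    have hd := (ht ((iterComp l n).symm s')).sub (ht ((iterComp l n).symm s))
    exact ⟨ge_of_tendsto hd (hb.mono fun m h => h.1), le_of_tendsto hd (hb.mono fun m h => h.2)⟩
  have hend : ∀ u : I, (∀ n, iterComp l n u = u) → f u = u := fun u hu =>
    tendsto_nhds_unique (hf u) (by simp [hu])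
  obtain ⟨L, hL, -⟩ := exists_orderIso_of_slope (f := f)
    (hend 0 fun n => (iterComp l n).map_bot) (hend 1 fun n => (iterComp l n).map_top)
    (c := 1) zero_le_one fun s s' hs => by
      have := hslope 0 s s' hs
      simpa [iterComp] using this
  refine ⟨L, fun n => (logSlopeCost_le_iff _ (by positivity)).2 fun s s' hs => ?_⟩
  simp only [OrderIso.trans_apply, hL]
  exact hslope n s s' hs

/-- Composed with `iterComp l n`, the functions `x n` become uniformly Cauchy, with limit `y`. If
`L` is the infinite composition, the limit sought is `y ∘ L.symm`, and `L` after the inverse of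
`iterComp l n` matches it with `x n`. -/
theorem CadlagMap.exists_limit {E : Type*} [PseudoEMetricSpace E] [CompleteSpace E]
    (x : ℕ → CadlagMap E) (hx : ∀ n, edist (x n) (x (n + 1)) < ENNReal.ofReal ((1 / 2) ^ (n + 1))) :
    ∃ y, Tendsto x atTop (𝓝 y) := by
  choose l hl hxl using fun n => timeChangeEDist_lt_iff.1 (hx n)
  obtain ⟨L, hL⟩ := exists_limit_iterComp fun n => (hl n).le
  have hstep : ∀ n t, edist ((x n).toFun (iterComp l n t))
      ((x (n + 1)).toFun (iterComp l (n + 1) t)) ≤ 1 / 2 / 2 ^ n := fun n t => by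
    refine ((le_iSup (fun u => edist ((x n).toFun u) ((x (n + 1)).toFun (l n u)))
      (iterComp l n t)).trans (hxl n).le).trans (le_of_eq ?_)
    rw [ENNReal.ofReal_pow (by norm_num), pow_succ', one_div, ENNReal.ofReal_inv_of_pos (by norm_num),
      ← ENNReal.inv_pow]
    simp [div_eq_mul_inv]
  choose y hy using fun t => cauchySeq_tendsto_of_complete
    (cauchySeq_of_edist_le_geometric_two (1 / 2) (by simp) (hstep · t))
  have hyb : ∀ n t, edist ((x n).toFun (iterComp l n t)) (y t) ≤ 2 * (1 / 2) / 2 ^ n := fun n t =>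
    edist_le_of_edist_le_geometric_two_of_tendsto (1 / 2) (hstep · t) (hy t) n
  have hlim : Tendsto (fun n : ℕ => ENNReal.ofReal ((1 / 2) ^ n)) atTop (𝓝 0) := by
    rw [← ENNReal.ofReal_zero]
    exact ENNReal.tendsto_ofReal (tendsto_pow_atTop_nhds_zero_of_lt_one (by norm_num) (by norm_num))
  have hyb' : ∀ n t, edist ((x n).toFun (iterComp l n t)) (y t) ≤ ENNReal.ofReal ((1 / 2) ^ n) :=
    fun n t => (hyb n t).trans (le_of_eq (by
      rw [ENNReal.ofReal_pow (by norm_num), one_div, one_div,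
        ENNReal.ofReal_inv_of_pos (by norm_num), ENNReal.mul_inv_cancel (by simp) (by simp),
        ← ENNReal.inv_pow]
      simp))
  have hyc : IsCadlag y := isCadlag_of_uniform_approx fun ε hε => by
    obtain ⟨n, hn⟩ := (hlim.eventually (gt_mem_nhds hε)).exists
    exact ⟨_, (x n).cadlag.comp_orderIso (iterComp l n), fun t => (hyb' n t).trans hn.le⟩
  refine ⟨⟨y ∘ L.symm, hyc.comp_orderIso _⟩, ?_⟩
  rw [tendsto_iff_edist_tendsto_0]
  refine tendsto_of_tendsto_of_tendsto_of_le_of_le tendsto_const_nhds hlim (fun _ => zero_le)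
    fun n => timeChangeEDist_le _ (hL n) fun t => ?_
  have := hyb' n ((iterComp l n).symm t)
  simpa using this

instance {E : Type*} [PseudoEMetricSpace E] [CompleteSpace E] : CompleteSpace (CadlagMap E) :=
  EMetric.complete_of_convergent_controlled_sequences
    (fun n => ENNReal.ofReal ((1 / 2) ^ (n + 1))) (fun n => by simp) fun x hx =>
    CadlagMap.exists_limit x fun n => hx n n (n + 1) le_rfl n.le_succ

/-! ### Moduli: stability under time changes and vanishing for càdlàg functions -/

section Modulus

variable {E : Type*} [PseudoEMetricSpace E] {x y : I → E} {δ δ' : ℝ} {ε η : ℝ≥0∞}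

theorem edist_le_osc {S : Set I} {s t : I} (hs : s ∈ S) (ht : t ∈ S) :
    edist (x s) (x t) ≤ osc x S :=
  le_iSup₂_of_le s hs (le_iSup₂_of_le t ht le_rfl)

theorem osc_le {S : Set I} (h : ∀ s ∈ S, ∀ t ∈ S, edist (x s) (x t) ≤ ε) : osc x S ≤ ε :=
  iSup₂_le fun s hs => iSup₂_le fun t ht => h s hs t ht

theorem osc_mono {S S' : Set I} (h : S ⊆ S') : osc x S ≤ osc x S' :=
  osc_le fun _ hs _ hs' => edist_le_osc (h hs) (h hs')

theorem modulus_lt_iff : modulus x δ < ε ↔ ∃ (v : ℕ) (t : Fin (v + 1) → I), IsSparse δ t ∧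
    ⨆ i : Fin v, osc x (Set.Ico (t i.castSucc) (t i.succ)) < ε := by
  simp [modulus, iInf_lt_iff]

theorem modulus_le {v : ℕ} {t : Fin (v + 1) → I} (ht : IsSparse δ t)
    (h : ∀ i : Fin v, osc x (Set.Ico (t i.castSucc) (t i.succ)) ≤ ε) : modulus x δ ≤ ε :=
  iInf_le_of_le v (iInf_le_of_le t (iInf_le_of_le ht (iSup_le h)))

theorem IsSparse.mono {v : ℕ} {t : Fin (v + 1) → I} (ht : IsSparse δ t) (h : δ' ≤ δ) :
    IsSparse δ' t :=
  ⟨ht.first, ht.last, ht.strictMono, fun i => h.trans_lt (ht.gap i)⟩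

theorem modulus_mono (h : δ' ≤ δ) : modulus x δ' ≤ modulus x δ :=
  le_iInf fun _ => le_iInf fun t => le_iInf fun ht =>
    iInf_le_of_le _ (iInf_le_of_le t (iInf_le_of_le (ht.mono h) le_rfl))

theorem IsSparse.exists_mem_Ico {v : ℕ} {t : Fin (v + 1) → I} (ht : IsSparse δ t) {s : I}
    (hs : s < 1) : ∃ i : Fin v, s ∈ Set.Ico (t i.castSucc) (t i.succ) := by
  by_contra! H
  have : ∀ i : Fin (v + 1), t i ≤ s := by
    intro i
    induction i using Fin.induction with
    | zero => rw [ht.first]; exact s.2.1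
    | succ i ih => exact not_lt.1 fun h => H i ⟨ih, h⟩
  have h := this (Fin.last v)
  rw [ht.last] at h
  exact absurd hs (not_lt.2 h)

/-- The modulus is stable under time changes and uniform perturbations. -/
theorem modulus_le_of_timeChange (l : I ≃o I)
    (hl : ∀ s s' : I, δ < (s' : ℝ) - s → δ' < (l s' : ℝ) - l s)
    (h : ∀ t, edist (x t) (y (l t)) ≤ η) : modulus y δ' ≤ modulus x δ + 2 * η := by
  refine ENNReal.le_of_forall_pos_le_add fun ε hε hfin => ?_
  have hx : modulus x δ < ⊤ := lt_of_le_of_lt le_self_add hfin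
  obtain ⟨v, t, ht, hosc⟩ := modulus_lt_iff.1
    (ENNReal.lt_add_right hx.ne (ENNReal.coe_pos.2 hε).ne')
  have ht' : IsSparse δ' (l ∘ t) :=
    ⟨(congrArg l ht.first).trans l.map_bot, (congrArg l ht.last).trans l.map_top,
      l.strictMono.comp ht.strictMono, fun i => hl _ _ (ht.gap i)⟩
  refine modulus_le ht' fun i => osc_le fun s hs s' hs' => ?_
  have mem : ∀ u ∈ Set.Ico ((l ∘ t) i.castSucc) ((l ∘ t) i.succ),
      l.symm u ∈ Set.Ico (t i.castSucc) (t i.succ) := fun u hu =>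
    ⟨l.le_symm_apply.2 hu.1, l.symm_apply_lt.2 hu.2⟩
  have hd : ∀ u, edist (x (l.symm u)) (y u) ≤ η := fun u => by simpa using h (l.symm u)
  calc edist (y s) (y s') ≤ edist (y s) (x (l.symm s)) + edist (x (l.symm s)) (x (l.symm s'))
        + edist (x (l.symm s')) (y s') := edist_triangle4 _ _ _ _
    _ ≤ η + (modulus x δ + ε) + η := by
        gcongr
        · rw [edist_comm]; exact hd s
        · exact (edist_le_osc (mem s hs) (mem s' hs')).trans
            ((le_iSup (fun i : Fin v => osc x (Set.Ico (t i.castSucc) (t i.succ))) i).trans hosc.le)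
        · exact hd s'
    _ = modulus x δ + 2 * η + ε := by ring

/-- A càdlàg function has finitely many oscillation intervals. -/
theorem IsCadlag.exists_isSparse (hx : IsCadlag x) (hε : 0 < ε) :
    ∃ (v : ℕ) (t : Fin (v + 1) → I), t 0 = 0 ∧ t (Fin.last v) = 1 ∧ StrictMono t ∧
      ∀ i : Fin v, osc x (Set.Ico (t i.castSucc) (t i.succ)) ≤ ε := by
  classical
  have hε2 : 0 < ε / 2 := ENNReal.div_pos hε.ne' (by simp)
  have near : ∀ (S : Set I) (a : E), (∀ s ∈ S, edist (x s) a < ε / 2) → osc x S ≤ ε :=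
    fun S a h => osc_le fun s hs s' hs' => (edist_triangle_right _ _ a).trans
      ((add_le_add (h s hs).le (h s' hs').le).trans_eq (ENNReal.add_halves ε))
  have left : ∀ t : I, ∃ a : I, (0 < t → a < t) ∧ osc x (Set.Ioo a t) ≤ ε := fun t => by
    by_cases ht : 0 < t
    · obtain ⟨c, hc⟩ := hx.2 t ht
      have := EMetric.tendsto_nhds.1 hc (ε / 2) hε2
      obtain ⟨a, ha, hat⟩ := (mem_nhdsLT_iff_exists_Ioo_subset' ht).1 this
      exact ⟨a, fun _ => ha, near _ c fun s hs => hat hs⟩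
    · refine ⟨0, fun h => absurd h ht, ?_⟩
      simp [Set.Ioo_eq_empty ht, osc]
  have right : ∀ t : I, ∃ b : I, (t < 1 → t < b) ∧ osc x (Set.Ico t b) ≤ ε := fun t => by
    by_cases ht : t < 1
    · have := EMetric.tendsto_nhds.1 (hx.1 t) (ε / 2) hε2
      obtain ⟨b, hb, hbt⟩ := (mem_nhdsGE_iff_exists_Ico_subset' ht).1 this
      exact ⟨b, fun _ => hb, near _ (x t) fun s hs => hbt hs⟩
    · refine ⟨0, fun h => absurd h ht, ?_⟩
      simp [osc]
  choose a ha hao using left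
  choose b hb hbo using right
  -- The implications drop the void constraint at each endpoint of [0,1], where `a` or `b` is a
  -- dummy value.
  let U : I → Set I := fun t => {s | (0 < t → a t < s) ∧ (t < 1 → s < b t)}
  have hU : ∀ t, U t ∈ 𝓝 t := fun t => by
    refine inter_mem ?_ ?_
    · by_cases h : 0 < t
      · filter_upwards [lt_mem_nhds (ha t h)] with s hs _ using hs
      · exact univ_mem' fun s h' => absurd h' h
    · by_cases h : t < 1
      · filter_upwards [gt_mem_nhds (hb t h)] with s hs _ using hs
      · exact univ_mem' fun s h' => absurd h' h
  obtain ⟨T, -, hT⟩ := isCompact_univ.elim_nhds_subcover U fun t _ => hU t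
  -- With the centres `u` and the points `b u` as nodes, a cell whose left end lies in `U u` stays
  -- inside `Ioo (a u) u` or inside `Ico u (b u)`.
  let F : Finset I := insert 0 (insert 1 (T ∪ T.image b))
  have hF0 : (0 : I) ∈ F := by simp [F]
  have hF1 : (1 : I) ∈ F := by simp [F]
  obtain ⟨v, hv⟩ : ∃ v, F.card = v + 1 := Nat.exists_eq_succ_of_ne_zero
    (Finset.card_ne_zero_of_mem hF0)
  let t := F.orderEmbOfFin hv
  have hsurj : ∀ u ∈ F, ∃ j, t j = u := fun u hu => by
    have : u ∈ Set.range t := by rw [Finset.range_orderEmbOfFin]; exact hu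
    exact this
  have hgap : ∀ (i : Fin v) (u : I), u ∈ F → t i.castSucc < u → t i.succ ≤ u := fun i u hu h => by
    obtain ⟨j, rfl⟩ := hsurj u hu
    exact t.monotone (Fin.castSucc_lt_iff_succ_le.1 (t.lt_iff_lt.1 h))
  refine ⟨v, t, ?_, ?_, t.strictMono, fun i => ?_⟩
  · obtain ⟨j, hj⟩ := hsurj 0 hF0
    exact le_antisymm (hj ▸ t.monotone (Fin.zero_le j)) (t 0).2.1
  · obtain ⟨j, hj⟩ := hsurj 1 hF1
    exact le_antisymm (t _).2.2 (hj ▸ t.monotone (Fin.le_last j))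
  · have hp1 : t i.castSucc < 1 := lt_of_lt_of_le
      (t.strictMono (Fin.castSucc_lt_succ (i := i))) (t i.succ).2.2
    have hmem := hT (Set.mem_univ (t i.castSucc))
    simp only [Set.mem_iUnion] at hmem
    obtain ⟨u, hu, h1, h2⟩ := hmem
    rcases lt_or_ge (t i.castSucc) u with h | h
    · have h3 := hgap i u (by simp [F, hu]) h
      have h0 := h1 (lt_of_le_of_lt (t i.castSucc).2.1 h)
      refine (osc_mono ?_).trans (hao u)
      exact fun s hs => ⟨h0.trans_le hs.1, hs.2.trans_le h3⟩
    · have hbF : b u ∈ F := by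
        simp only [F, Finset.mem_insert, Finset.mem_union]
        exact Or.inr (Or.inr (Or.inr (Finset.mem_image_of_mem b hu)))
      have h3 := hgap i (b u) hbF (h2 (h.trans_lt hp1))
      refine (osc_mono ?_).trans (hbo u)
      exact fun s hs => ⟨h.trans hs.1, hs.2.trans_le h3⟩

theorem IsCadlag.eventually_exists_isSparse (hx : IsCadlag x) (hε : 0 < ε) :
    ∀ᶠ δ in 𝓝[>] (0 : ℝ), ∃ (v : ℕ) (t : Fin (v + 1) → I), IsSparse δ t ∧
      ∀ i : Fin v, osc x (Set.Ico (t i.castSucc) (t i.succ)) ≤ ε := by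
  obtain ⟨v, t, h0, h1, hm, ho⟩ := hx.exists_isSparse hε
  have : ∀ᶠ δ in 𝓝[>] (0 : ℝ), ∀ i : Fin v, δ < (t i.succ : ℝ) - t i.castSucc :=
    eventually_all.2 fun i => nhdsWithin_le_nhds
      (gt_mem_nhds (sub_pos.2 (hm (Fin.castSucc_lt_succ (i := i)))))
  exact this.mono fun δ hδ => ⟨v, t, ⟨h0, h1, hm, hδ⟩, ho⟩

theorem IsCadlag.eventually_modulus_le (hx : IsCadlag x) (hε : 0 < ε) :
    ∀ᶠ δ in 𝓝[>] (0 : ℝ), modulus x δ ≤ ε :=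
  (hx.eventually_exists_isSparse hε).mono fun _ ⟨_, _, ht, h⟩ => modulus_le ht h

end Modulus

/-! ### Total boundedness -/

/-- The largest multiple of `1 / N` which is at most `s`. -/
noncomputable def gridFloor (N : ℕ) (s : I) : I :=
  ⟨⌊(N : ℝ) * s⌋₊ / N, by positivity, div_le_one_of_le₀
    ((Nat.floor_le (mul_nonneg N.cast_nonneg s.2.1)).trans
      (mul_le_of_le_one_right N.cast_nonneg s.2.2)) N.cast_nonneg⟩

theorem gridFloor_le {N : ℕ} (hN : 0 < N) (s : I) : gridFloor N s ≤ s := by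
  have hN' : (0 : ℝ) < N := by exact_mod_cast hN
  rw [← Subtype.coe_le_coe, gridFloor, div_le_iff₀' hN']
  exact Nat.floor_le (mul_nonneg hN'.le s.2.1)

theorem sub_gridFloor_le {N : ℕ} (hN : 0 < N) (s : I) : (s : ℝ) - gridFloor N s ≤ 1 / N := by
  have hN' : (0 : ℝ) < N := by exact_mod_cast hN
  have := (Nat.lt_floor_add_one ((N : ℝ) * s)).le
  simp only [gridFloor]
  rw [sub_le_iff_le_add, ← add_div, le_div_iff₀ hN']
  linarith

theorem floor_mul_gridFloor {N : ℕ} (hN : 0 < N) (s : I) : ⌊(N : ℝ) * gridFloor N s⌋₊ = ⌊(N : ℝ) * s⌋₊ := by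
  have hN' : (N : ℝ) ≠ 0 := by exact_mod_cast hN.ne'
  simp only [gridFloor]
  rw [mul_div_cancel₀ _ hN', Nat.floor_natCast]

theorem gridFloor_gridFloor {N : ℕ} (hN : 0 < N) (s : I) : gridFloor N (gridFloor N s) = gridFloor N s := by
  ext
  have := floor_mul_gridFloor hN s
  simp only [gridFloor] at this ⊢
  rw [this]

theorem gridFloor_one {N : ℕ} (hN : 0 < N) : gridFloor N 1 = 1 := by
  have hN' : (N : ℝ) ≠ 0 := by exact_mod_cast hN.ne'
  ext
  simp [gridFloor, hN']

theorem gridFloor_zero {N : ℕ} : gridFloor N 0 = 0 := by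
  ext
  simp [gridFloor]

theorem gridFloor_mono {N : ℕ} : Monotone (gridFloor N) := fun s t h => by
  rw [← Subtype.coe_le_coe] at h ⊢
  simp only [gridFloor]
  gcongr

theorem IsSparse.lt_abs_sub {δ : ℝ} {v : ℕ} {t : Fin (v + 1) → I} (ht : IsSparse δ t)
    {i j : Fin (v + 1)} (h : i ≠ j) : δ < |(t i : ℝ) - t j| := by
  wlog hij : i < j generalizing i j
  · rw [abs_sub_comm]
    exact this h.symm (lt_of_le_of_ne (not_lt.1 hij) h.symm)
  obtain ⟨k, rfl⟩ := Fin.exists_castSucc_eq.2 (hij.trans_le (Fin.le_last j)).ne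
  have h1 : (t k.succ : ℝ) ≤ t j :=
    ht.strictMono.monotone (Fin.castSucc_lt_iff_succ_le.1 hij)
  have h2 := ht.gap k
  rw [abs_sub_comm]
  exact lt_of_lt_of_le (by linarith) (le_abs_self _)

/-- A function with small modulus is close to its own discretization along a suitable time
change of small cost. -/
theorem exists_timeChange_gridFloor {E : Type*} [PseudoEMetricSpace E] {x : I → E} {δ e : ℝ}
    {ε : ℝ≥0∞} (he : 0 < e) (he2 : e ≤ 1 / 2) {N : ℕ} (hN : 0 < N)
    (hNδ : 1 / (N : ℝ) ≤ e * δ) (hx : modulus x δ < ε) :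
    ∃ l : I ≃o I, logSlopeCost l ≤ ENNReal.ofReal (2 * e) ∧
      ∀ s, edist (x s) (x (l.symm (gridFloor N (l s)))) ≤ ε := by
  obtain ⟨v, t, ht, hosc⟩ := modulus_lt_iff.1 hx
  -- Rounding down moves each node by at most 1/N ≤ eδ, while distinct nodes are more than δ apart:
  -- the displacement is `e`-Lipschitz on the nodes.
  obtain ⟨l, hl, hlc⟩ := exists_orderIso_eqOn (S := Set.range t) ⟨0, ht.first⟩
    ⟨Fin.last v, ht.last⟩ (g := gridFloor N) gridFloor_zero (gridFloor_one hN) he.le he2 (by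
      rintro _ ⟨i, rfl⟩ _ ⟨j, rfl⟩
      rcases eq_or_ne i j with rfl | hij
      · simp
      have hd := ht.lt_abs_sub hij
      have h1 : (gridFloor N (t i) : ℝ) ≤ t i := gridFloor_le hN _
      have h2 : (gridFloor N (t j) : ℝ) ≤ t j := gridFloor_le hN _
      have h3 := sub_gridFloor_le hN (t i)
      have h4 := sub_gridFloor_le hN (t j)
      have h5 : e * δ ≤ e * |(t i : ℝ) - t j| := by gcongr
      rw [abs_le]
      constructor <;> linarith)
  refine ⟨l, hlc, fun s => ?_⟩
  -- The point 1 lies in no half-open cell, but every map involved fixes it.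
  rcases eq_or_lt_of_le (show s ≤ 1 from s.2.2) with rfl | hs
  · have h1 : l 1 = 1 := l.map_top
    have h2 : l.symm 1 = 1 := l.symm.map_top
    simp [h1, h2, gridFloor_one hN]
  obtain ⟨i, hi⟩ := ht.exists_mem_Ico hs
  refine (edist_le_osc hi (S := Set.Ico (t i.castSucc) (t i.succ)) ⟨?_, ?_⟩).trans
    ((le_iSup (fun i : Fin v => osc x (Set.Ico (t i.castSucc) (t i.succ))) i).trans hosc.le)
  -- The image of a node is a grid point, so rounding down `l s` cannot fall below it and stays in
  -- the same cell.
  · have h1 := gridFloor_mono (N := N) (l.monotone hi.1)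
    rw [hl _ ⟨_, rfl⟩, gridFloor_gridFloor hN, ← hl _ ⟨_, rfl⟩] at h1
    exact l.le_symm_apply.2 h1
  · exact l.symm_apply_lt.2 ((gridFloor_le hN _).trans_lt (l.strictMono hi.2))

/-- A set of càdlàg functions with values in a totally bounded set and with uniformly small
moduli is totally bounded. -/
theorem CadlagMap.totallyBounded {E : Type*} [PseudoEMetricSpace E] {A : Set (CadlagMap E)}
    {C : Set E} (hC : TotallyBounded C) (hAC : ∀ x ∈ A, ∀ t, x.toFun t ∈ C)
    (hA : ∀ ε : ℝ≥0∞, 0 < ε → ∃ δ : ℝ, 0 < δ ∧ ∀ x ∈ A, modulus x.toFun δ < ε) :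
    TotallyBounded A := by
  rw [EMetric.totallyBounded_iff]
  intro ε hε
  obtain ⟨e, he0, heε⟩ := ENNReal.lt_iff_exists_nnreal_btwn.1 hε
  obtain ⟨e', he', he2, hee⟩ : ∃ e' : ℝ, 0 < e' ∧ e' ≤ 1 / 2 ∧ 2 * e' ≤ e := by
    have : (0 : ℝ) < e := by exact_mod_cast he0
    exact ⟨min (1 / 2) (e / 2), by positivity, min_le_left _ _, by
      linarith [min_le_right (1 / 2 : ℝ) (e / 2)]⟩
  have hη : 0 < ENNReal.ofReal e' := ENNReal.ofReal_pos.2 he'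
  have hηε : ENNReal.ofReal (2 * e') < ε :=
    lt_of_le_of_lt (by rw [← ENNReal.ofReal_coe_nnreal]; exact ENNReal.ofReal_le_ofReal hee) heε
  obtain ⟨δ, hδ, hmod⟩ := hA _ hη
  obtain ⟨H, hHfin, hH⟩ := EMetric.totallyBounded_iff.1 hC _ hη
  obtain ⟨M, hM⟩ := exists_nat_gt (1 / (e' * δ))
  have hMpos : (0 : ℝ) < M := lt_trans (by positivity) hM
  have hN : 0 < M := by exact_mod_cast hMpos
  have hNδ : 1 / (M : ℝ) ≤ e' * δ := by
    rw [div_le_comm₀ hMpos (by positivity)]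
    exact hM.le
  have happ : ∀ c ∈ C, ∃ h ∈ H, edist c h ≤ ENNReal.ofReal e' := fun c hc => by
    have := hH hc
    simp only [Set.mem_iUnion] at this
    obtain ⟨h, hh, hd⟩ := this
    exact ⟨h, hh, le_of_lt hd⟩
  -- There are M + 1 grid cells because s = 1 forms its own; the reduction mod M + 1 in `Fin.ofNat`
  -- never acts on the indices that occur.
  let step : (Fin (M + 1) → E) → CadlagMap E := fun p =>
    ⟨_, isCadlag_step hN fun k => p (Fin.ofNat (M + 1) k)⟩
  refine ⟨step '' Set.univ.pi fun _ => H, (Set.Finite.pi fun _ => hHfin).image _, fun x hx => ?_⟩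
  obtain ⟨l, hlc, hl⟩ := exists_timeChange_gridFloor he' he2 hN hNδ (hmod x hx)
  have hq : ∀ j : Fin (M + 1), (j : ℝ) / M ∈ I := fun j =>
    ⟨by positivity, div_le_one_of_le₀ (by exact_mod_cast j.is_le) hMpos.le⟩
  choose p hpH hp using fun j : Fin (M + 1) => happ _ (hAC x hx (l.symm ⟨_, hq j⟩))
  simp only [Set.mem_iUnion]
  refine ⟨step p, ⟨p, fun i _ => hpH i, rfl⟩, ?_⟩
  refine lt_of_le_of_lt (timeChangeEDist_le l hlc fun s => ?_) hηε
  have hlt : ⌊(M : ℝ) * l s⌋₊ < M + 1 := by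
    rw [Nat.lt_succ_iff]
    exact Nat.floor_le_of_le (mul_le_of_le_one_right hMpos.le (l s).2.2)
  have hgrid : (⟨_, hq (Fin.ofNat (M + 1) ⌊(M : ℝ) * l s⌋₊)⟩ : I) = gridFloor M (l s) := by
    ext
    simp [gridFloor, Nat.mod_eq_of_lt hlt]
  have h1 := hp (Fin.ofNat (M + 1) ⌊(M : ℝ) * l s⌋₊)
  rw [hgrid] at h1
  rw [two_mul, ENNReal.ofReal_add he'.le he'.le]
  exact (edist_triangle _ _ _).trans (add_le_add (hl s) h1)

/-! ### Sets shrinking to the empty set locally uniformly -/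

section Vanishing

variable {X ι : Type*} [TopologicalSpace X] {f : Filter ι} {B : ι → Set X}

/-- The sets `B i` are eventually decreasing and each point has a neighbourhood which is eventually
disjoint from `B i`. -/
structure LocallyVanishing (f : Filter ι) (B : ι → Set X) : Prop where
  disjoint : ∀ x, ∃ U ∈ 𝓝 x, ∀ᶠ i in f, Disjoint U (B i)
  subset : ∀ᶠ i in f, ∀ᶠ j in f, B j ⊆ B i

theorem LocallyVanishing.eventually_disjoint (h : LocallyVanishing f B) {K : Set X}
    (hK : IsCompact K) : ∀ᶠ i in f, Disjoint K (B i) := by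
  refine hK.induction_on (p := fun s => ∀ᶠ i in f, Disjoint s (B i)) (by simp)
    (fun s t hst ht => ht.mono fun i hi => hi.mono_left hst)
    (fun s t hs ht => (hs.and ht).mono fun i hi => Set.disjoint_union_left.2 hi) fun x _ => ?_
  obtain ⟨U, hU, h⟩ := h.disjoint x
  exact ⟨U, nhdsWithin_le_nhds hU, h⟩

variable [MeasurableSpace X]

/-- The sets `B i` need not be measurable. Along a sequence they are enclosed in the closures of
their tail unions, closed sets that decrease to ∅ by local vanishing. -/
theorem LocallyVanishing.tendsto_measure [OpensMeasurableSpace X] [f.IsCountablyGenerated] (h : LocallyVanishing f B)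
    (μ : Measure X) [IsFiniteMeasure μ] : Tendsto (fun i => μ (B i)) f (𝓝 0) := by
  refine tendsto_of_seq_tendsto fun u hu => ?_
  let V : ℕ → Set X := fun N => (interior (⋂ n ≥ N, (B (u n))ᶜ))ᶜ
  have hV : Tendsto (μ ∘ V) atTop (𝓝 (μ (⋂ n, V n))) := by
    refine tendsto_measure_iInter_atTop
      (fun N => isOpen_interior.measurableSet.compl.nullMeasurableSet) ?_
      ⟨0, measure_ne_top _ _⟩
    intro N M hNM
    refine Set.compl_subset_compl.2 (interior_mono ?_)
    exact Set.biInter_subset_biInter_left fun n (hn : M ≤ n) => hNM.trans hn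
  have hempty : ⋂ n, V n = ∅ := by
    refine Set.eq_empty_of_forall_notMem fun x hx => ?_
    obtain ⟨U, hU, hd⟩ := h.disjoint x
    obtain ⟨N, hN⟩ := eventually_atTop.1 (hu.eventually hd)
    refine Set.mem_iInter.1 hx N (mem_interior_iff_mem_nhds.2 (mem_of_superset hU ?_))
    exact Set.subset_iInter₂ fun n hn => (hN n hn).subset_compl_right
  rw [hempty, measure_empty] at hV
  refine tendsto_of_tendsto_of_tendsto_of_le_of_le tendsto_const_nhds hV (fun _ => zero_le)
    fun N => measure_mono ?_
  intro x hx hx'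
  exact Set.mem_iInter₂.1 (interior_subset hx') N le_rfl hx

theorem LocallyVanishing.tendsto_limsup (h : LocallyVanishing f B) {P : ℕ → Measure X}
    (hP : IsTightMeasureSet (Set.range P)) :
    Tendsto (fun i => limsup (fun n => P n (B i)) atTop) f (𝓝 0) := by
  refine ENNReal.tendsto_nhds_zero.2 fun ε hε => ?_
  obtain ⟨K, hK, hPK⟩ := isTightMeasureSet_iff_exists_isCompact_measure_compl_le.1 hP ε hε
  filter_upwards [h.eventually_disjoint hK] with i hi
  exact limsup_le_of_le (by isBoundedDefault) (Eventually.of_forall fun n =>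
    (measure_mono hi.subset_compl_left).trans (hPK _ ⟨n, rfl⟩))

/-- The limsup controls all but finitely many n, at one index and hence at later ones by
monotonicity; the remaining measures are treated one at a time by `tendsto_measure`. -/
theorem LocallyVanishing.eventually_forall_le [OpensMeasurableSpace X] [f.IsCountablyGenerated] [f.NeBot]
    (h : LocallyVanishing f B) {P : ℕ → Measure X} (hP : ∀ n, IsProbabilityMeasure (P n))
    (hlim : Tendsto (fun i => limsup (fun n => P n (B i)) atTop) f (𝓝 0))
    {η : ℝ≥0∞} (hη : 0 < η) : ∀ᶠ i in f, ∀ n, P n (B i) ≤ η := by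
  obtain ⟨i, hi, hsub⟩ := ((hlim.eventually (gt_mem_nhds hη)).and h.subset).exists
  obtain ⟨N, hN⟩ := eventually_atTop.1 (eventually_lt_of_limsup_lt hi)
  have hfin : ∀ᶠ j in f, ∀ n ∈ Finset.range N, P n (B j) ≤ η :=
    (eventually_all_finset _).2 fun n _ =>
      ENNReal.tendsto_nhds_zero.1 (h.tendsto_measure (P n)) η hη
  filter_upwards [hsub, hfin] with j hj hj' n
  rcases lt_or_ge n N with hn | hn
  · exact hj' n (Finset.mem_range.2 hn)
  · exact (measure_mono hj).trans (hN n hn).le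

end Vanishing

/-! ### Stability of norms and moduli -/

/-- Every value is within 1 of a value at one of finitely many nodes. Used with the absolute value
on ℝ, then with the norm on 𝔻. -/
theorem IsCadlag.exists_bound {E : Type*} [PseudoEMetricSpace E] {x : I → E} (hx : IsCadlag x)
    {f : E → ℝ≥0∞} (hf : ∀ a b, f a ≤ f b + edist a b) (hf' : ∀ a, f a < ⊤) :
    ∃ C < ⊤, ∀ t, f (x t) ≤ C := by
  obtain ⟨δ, v, t, ht, ho⟩ := (hx.eventually_exists_isSparse one_pos).exists
  refine ⟨∑ i, f (x (t i)) + 1, ENNReal.add_lt_top.2 ⟨ENNReal.sum_lt_top.2 fun i _ => hf' _,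
    ENNReal.one_lt_top⟩, fun s => ?_⟩
  have hsum : ∀ i, f (x (t i)) ≤ ∑ i, f (x (t i)) := fun i =>
    Finset.single_le_sum (f := fun i => f (x (t i))) (fun _ _ => zero_le) (Finset.mem_univ i)
  rcases eq_or_lt_of_le (show s ≤ 1 from s.2.2) with rfl | hs
  · rw [← ht.last]
    exact (hsum _).trans le_self_add
  · obtain ⟨i, hi⟩ := ht.exists_mem_Ico hs
    have hmem : t i.castSucc ∈ Set.Ico (t i.castSucc) (t i.succ) :=
      Set.left_mem_Ico.2 (ht.strictMono (Fin.castSucc_lt_succ (i := i)))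
    exact (hf _ _).trans (add_le_add (hsum _) ((edist_le_osc hi hmem).trans (ho i)))

theorem D.supNorm_le_add_edist (y z : D) : y.supNorm ≤ z.supNorm + edist y z := by
  change _ ≤ _ + timeChangeEDist logSlopeCost y z
  rw [timeChangeEDist, ENNReal.add_iInf]
  refine le_iInf fun l => iSup_le fun s => ?_
  have h1 : ‖z (l s)‖ₑ ≤ z.supNorm := le_iSup (fun s => ‖z s‖ₑ) (l s)
  have h2 : edist (y s) (z (l s)) ≤ ⨆ s, edist (y s) (z (l s)) :=
    le_iSup (fun s => edist (y s) (z (l s))) s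
  refine le_trans ?_ (add_le_add h1 (h2.trans (le_max_right _ _)))
  have := edist_triangle (y s) (z (l s)) 0
  rw [edist_zero_right, edist_zero_right] at this
  rwa [add_comm]

theorem D.supNorm_lt_top (y : D) : y.supNorm < ⊤ := by
  obtain ⟨C, hC, h⟩ := y.cadlag.exists_bound (f := fun a : ℝ => ‖a‖ₑ) (fun a b => by
    have := edist_triangle a b 0
    rw [edist_zero_right, edist_zero_right] at this
    rwa [add_comm]) fun a => enorm_lt_top
  exact (iSup_le h).trans_lt hC

theorem DD.supNorm_lt_top (x : DD) : x.supNorm < ⊤ := by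
  obtain ⟨C, hC, h⟩ := x.cadlag.exists_bound D.supNorm_le_add_edist D.supNorm_lt_top
  exact (iSup_le h).trans_lt hC

/-- The slopes of the time change are at least exp (-c) ≥ 1/2, so gaps above 2δ remain above δ. -/
theorem D.modulus_le_of_edist_lt {y z : D} {δ b c : ℝ} (hδ : 0 < δ) (hb : 0 ≤ b)
    (hc : c ≤ 1 / 2) (h : edist y z < ENNReal.ofReal c)
    (hy : modulus y (2 * δ) ≤ ENNReal.ofReal b) : modulus z δ ≤ ENNReal.ofReal (b + 2 * c) := by
  have hc0 : 0 < c := ENNReal.ofReal_pos.1 (bot_le.trans_lt h)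
  obtain ⟨l, hl, hyz⟩ := timeChangeEDist_lt_iff.1 h
  refine (modulus_le_of_timeChange (δ := 2 * δ) l (fun s s' hs => ?_) fun t =>
    (le_iSup (fun t => edist (y t) (z (l t))) t).trans hyz.le).trans ?_
  · have := ((logSlopeCost_le_iff l hc0.le).1 hl.le s s'
      (Subtype.coe_lt_coe.1 (by linarith))).1
    have he : 1 / 2 ≤ Real.exp (-c) := by linarith [Real.add_one_le_exp (-c)]
    nlinarith
  · rw [ENNReal.ofReal_add hb (by positivity), ENNReal.ofReal_mul two_pos.le]
    gcongr
    simp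

theorem eventually_two_mul_nhdsGT {p : ℝ → Prop} (h : ∀ᶠ δ in 𝓝[>] (0 : ℝ), p δ) :
    ∀ᶠ δ in 𝓝[>] (0 : ℝ), p (2 * δ) := by
  have : Tendsto (fun δ : ℝ => 2 * δ) (𝓝[>] 0) (𝓝[>] 0) := by
    refine tendsto_nhdsWithin_of_tendsto_nhds_of_eventually_within _ ?_ ?_
    · have : Tendsto (fun δ : ℝ => 2 * δ) (𝓝 0) (𝓝 (2 * 0)) := by
        exact (continuous_const.mul continuous_id).tendsto 0
      rw [mul_zero] at this
      exact this.mono_left nhdsWithin_le_nhds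
    · filter_upwards [self_mem_nhdsWithin] with δ (hδ : 0 < δ)
      exact mul_pos two_pos hδ
  exact this.eventually h

/-- Uniformity in `t` holds because the whole path stays `J₁`-close to its values at finitely many
nodes, for which a common δ exists. -/
theorem DD.eventually_modulus_apply_le (x : DD) {ε : ℝ} (hε : 0 < ε) :
    ∀ᶠ δ in 𝓝[>] (0 : ℝ), ∀ t, modulus (x t) δ ≤ ENNReal.ofReal ε := by
  obtain ⟨c, hc0, hc, hcε⟩ : ∃ c : ℝ, 0 < c ∧ c ≤ 1 / 2 ∧ ε / 2 + 2 * c ≤ ε :=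
    ⟨min (1 / 2) (ε / 4), by positivity, min_le_left _ _, by
      linarith [min_le_right (1 / 2 : ℝ) (ε / 4)]⟩
  obtain ⟨r, v, t, ht, ho⟩ := (x.cadlag.eventually_exists_isSparse
    (ENNReal.ofReal_pos.2 (half_pos hc0))).exists
  have hall : ∀ᶠ δ in 𝓝[>] (0 : ℝ), ∀ i, modulus (x (t i)) δ ≤ ENNReal.ofReal (ε / 2) :=
    eventually_all.2 fun i => (x (t i)).cadlag.eventually_modulus_le
      (ENNReal.ofReal_pos.2 (half_pos hε))
  filter_upwards [eventually_two_mul_nhdsGT hall, self_mem_nhdsWithin] with δ hδ (hδ0 : 0 < δ) s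
  have key : ∀ i, edist (x (t i)) (x s) < ENNReal.ofReal c →
      modulus (x s) δ ≤ ENNReal.ofReal ε := fun i hi =>
    (D.modulus_le_of_edist_lt hδ0 (half_pos hε).le hc hi (hδ i)).trans
      (ENNReal.ofReal_le_ofReal hcε)
  rcases eq_or_lt_of_le (show s ≤ 1 from s.2.2) with rfl | hs
  · refine key (Fin.last v) ?_
    rw [ht.last, edist_self]
    exact ENNReal.ofReal_pos.2 hc0
  · obtain ⟨i, hi⟩ := ht.exists_mem_Ico hs
    have hmem : t i.castSucc ∈ Set.Ico (t i.castSucc) (t i.succ) :=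
      Set.left_mem_Ico.2 (ht.strictMono (Fin.castSucc_lt_succ (i := i)))
    exact key _ (((edist_le_osc hmem hi).trans (ho i)).trans_lt
      ((ENNReal.ofReal_lt_ofReal_iff hc0).2 (half_lt_self hc0)))

theorem DD.exists_timeChange {x y : DD} {c : ℝ} (h : edist x y < ENNReal.ofReal c) :
    ∃ l : I ≃o I, (∀ t, dist (l t) t < c) ∧ ∀ t, edist (x t) (y (l t)) < ENNReal.ofReal c := by
  obtain ⟨l, hl, hxy⟩ := timeChangeEDist_lt_iff.1 h
  exact ⟨l, fun t => edist_lt_ofReal.1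
    ((le_iSup (fun t : I => edist (l t) t) t).trans_lt hl), fun t =>
    (le_iSup (fun t => edist (x t) (y (l t))) t).trans_lt hxy⟩

theorem ball_mem_nhds_ofReal {X : Type*} [PseudoEMetricSpace X] (x : X) {c : ℝ} (hc : 0 < c) :
    {y | edist x y < ENNReal.ofReal c} ∈ 𝓝 x := by
  filter_upwards [Metric.eball_mem_nhds x (ENNReal.ofReal_pos.2 hc)] with y hy
  rw [edist_comm]
  exact hy

/-! ### Local vanishing of the three families of bad sets -/

theorem DD.locallyVanishing_supNorm :
    LocallyVanishing atTop fun a : ℝ => {x : DD | ENNReal.ofReal a ≤ x.supNorm} where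
  disjoint x := by
    refine ⟨_, ball_mem_nhds_ofReal x one_pos, ?_⟩
    filter_upwards [eventually_gt_atTop (x.supNorm + 1).toReal] with a ha
    have ha' : x.supNorm + 1 < ENNReal.ofReal a :=
      (ENNReal.lt_ofReal_iff_toReal_lt
        (ENNReal.add_lt_top.2 ⟨x.supNorm_lt_top, ENNReal.one_lt_top⟩).ne).2 ha
    refine Set.disjoint_left.2 fun y hy => not_le.2 (lt_of_le_of_lt (iSup_le fun t => ?_) ha')
    obtain ⟨l, -, hl⟩ := DD.exists_timeChange hy
    have h := hl (l.symm t)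
    rw [l.apply_symm_apply, ENNReal.ofReal_one, edist_comm] at h
    exact (D.supNorm_le_add_edist _ _).trans
      (add_le_add (le_iSup (fun t => (x t).supNorm) _) h.le)
  subset := Eventually.of_forall fun a => (eventually_ge_atTop a).mono fun _ hb _ hx =>
    (ENNReal.ofReal_le_ofReal hb).trans hx

theorem eventually_eventually_le_nhdsGT :
    ∀ᶠ r in 𝓝[>] (0 : ℝ), ∀ᶠ δ in 𝓝[>] (0 : ℝ), δ ≤ r := by
  filter_upwards [self_mem_nhdsWithin] with r (hr : 0 < r)
  exact nhdsWithin_le_nhds (Iic_mem_nhds hr)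

theorem DD.locallyVanishing_spaceModulus {ε : ℝ} (hε : 0 < ε) :
    LocallyVanishing (𝓝[>] 0) fun δ : ℝ =>
      {x : DD | ∃ t : I, ENNReal.ofReal ε ≤ modulus (x t) δ} where
  disjoint x := by
    obtain ⟨c, hc0, hc, hcε⟩ : ∃ c : ℝ, 0 < c ∧ c ≤ 1 / 2 ∧ ε / 2 + 2 * c < ε :=
      ⟨min (1 / 2) (ε / 8), by positivity, min_le_left _ _, by
        linarith [min_le_right (1 / 2 : ℝ) (ε / 8)]⟩
    refine ⟨_, ball_mem_nhds_ofReal x hc0, ?_⟩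
    filter_upwards [eventually_two_mul_nhdsGT (x.eventually_modulus_apply_le (half_pos hε)),
      self_mem_nhdsWithin] with δ hδ (hδ0 : 0 < δ)
    refine Set.disjoint_left.2 fun y hy ⟨t, ht⟩ => ht.not_gt ?_
    obtain ⟨l, -, hl⟩ := DD.exists_timeChange hy
    have h := hl (l.symm t)
    rw [l.apply_symm_apply] at h
    exact (D.modulus_le_of_edist_lt hδ0 (half_pos hε).le hc h (hδ _)).trans_lt
      ((ENNReal.ofReal_lt_ofReal_iff hε).2 hcε)
  subset := eventually_eventually_le_nhdsGT.mono fun _ hr => hr.mono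
    fun _ hδ _ ⟨t, ht⟩ => ⟨t, ht.trans (modulus_mono hδ)⟩

theorem DD.locallyVanishing_timeModulus {ε : ℝ} (hε : 0 < ε) :
    LocallyVanishing (𝓝[>] 0) fun δ : ℝ => {x : DD | ENNReal.ofReal ε ≤ modulus x δ} where
  disjoint x := by
    obtain ⟨r, hr, hr0 : 0 < r⟩ := ((x.cadlag.eventually_modulus_le
      (ENNReal.ofReal_pos.2 (half_pos hε))).and self_mem_nhdsWithin).exists
    -- Here slopes are not controlled: a displacement below `c` at both ends shortens a gap by less
    -- than 2c ≤ r/2, so gaps above r remain above r/2.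
    obtain ⟨c, hc0, hc, hcε⟩ : ∃ c : ℝ, 0 < c ∧ c ≤ r / 4 ∧ ε / 2 + 2 * c < ε :=
      ⟨min (r / 4) (ε / 8), by positivity, min_le_left _ _, by
        linarith [min_le_right (r / 4 : ℝ) (ε / 8)]⟩
    refine ⟨_, ball_mem_nhds_ofReal x hc0, ?_⟩
    filter_upwards [nhdsWithin_le_nhds (Iic_mem_nhds (half_pos hr0))] with δ (hδ : δ ≤ r / 2)
    refine Set.disjoint_left.2 fun y hy hy' =>
      not_lt.2 (show ENNReal.ofReal ε ≤ modulus y δ from hy') ?_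
    obtain ⟨l, hl, hxy⟩ := DD.exists_timeChange hy
    refine (modulus_le_of_timeChange (δ := r) (δ' := δ) l (fun s s' hs => ?_)
      fun t => (hxy t).le).trans_lt ?_
    · have h1 := hl s
      have h2 := hl s'
      rw [Subtype.dist_eq, Real.dist_eq, abs_lt] at h1 h2
      linarith [h1.2, h2.1]
    · refine lt_of_le_of_lt ?_ ((ENNReal.ofReal_lt_ofReal_iff hε).2 hcε)
      rw [ENNReal.ofReal_add (half_pos hε).le (by positivity), ENNReal.ofReal_mul two_pos.le]
      gcongr
      simp
  subset := eventually_eventually_le_nhdsGT.mono fun _ hr => hr.mono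
    fun _ hδ _ ht => le_trans ht (modulus_mono hδ)

/-! ### Compact sets -/

/-- `𝔻` is the space of càdlàg maps with values in `ℝ`. -/
noncomputable def D.isometryEquiv : D ≃ᵢ CadlagMap ℝ where
  toFun y := ⟨y.toFun, y.cadlag⟩
  invFun y := ⟨y.toFun, y.cadlag⟩
  left_inv _ := rfl
  right_inv _ := rfl
  isometry_toFun _ _ := rfl

instance : CompleteSpace D := D.isometryEquiv.completeSpace

theorem D.totallyBounded {C : Set D} {a : ℝ} (ha : ∀ y ∈ C, y.supNorm ≤ ENNReal.ofReal a)
    (hC : ∀ ε : ℝ≥0∞, 0 < ε → ∃ δ : ℝ, 0 < δ ∧ ∀ y ∈ C, modulus y δ < ε) : TotallyBounded C := by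
  have h : TotallyBounded (D.isometryEquiv.symm ⁻¹' C) := by
    refine CadlagMap.totallyBounded (isCompact_closedBall (0 : ℝ) (max a 0)).totallyBounded
      (fun y hy s => ?_) fun ε hε => ?_
    · have h1 := (le_iSup (fun s => ‖(D.isometryEquiv.symm y) s‖ₑ) s).trans (ha _ hy)
      rw [← ofReal_norm] at h1
      rw [mem_closedBall_zero_iff]
      exact (ENNReal.ofReal_le_ofReal_iff (le_max_right a 0)).1
        (h1.trans (ENNReal.ofReal_le_ofReal (le_max_left a 0)))
    · obtain ⟨δ, hδ, h⟩ := hC ε hε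
      exact ⟨δ, hδ, fun y hy => h (D.isometryEquiv.symm y) (Set.mem_preimage.1 hy)⟩
  have h' := totallyBounded_preimage D.isometryEquiv.isometry.isUniformInducing h
  rwa [← Set.preimage_comp, D.isometryEquiv.symm_comp_self, Set.preimage_id] at h'

/-- The map from càdlàg maps with the complete distance to `𝔻([0,1]; 𝔻)`. -/
def DD.ofCadlagMap (x : CadlagMap D) : DD := ⟨x.toFun, x.cadlag⟩

/-- A small log-slope cost forces a small uniform displacement, so the distance on the source is
locally the stronger one. -/
theorem DD.continuous_ofCadlagMap : Continuous DD.ofCadlagMap := by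
  refine continuous_iff_continuousAt.2 fun x => EMetric.tendsto_nhds.2 fun ε hε => ?_
  obtain ⟨e, he0, heε⟩ := ENNReal.lt_iff_exists_nnreal_btwn.1 hε
  have he0' : (0 : ℝ) < e := by exact_mod_cast he0
  obtain ⟨c, hc0, hc1, hc⟩ : ∃ c : ℝ, 0 < c ∧ c ≤ 1 ∧ 2 * c ≤ e :=
    ⟨min 1 (e / 2), by positivity, min_le_left _ _, by linarith [min_le_right (1 : ℝ) (e / 2)]⟩
  filter_upwards [ball_mem_nhds_ofReal x hc0] with y hy
  rw [edist_comm]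
  obtain ⟨l, hl, hxy⟩ := timeChangeEDist_lt_iff.1 (show timeChangeEDist _ _ _ < _ from hy)
  have h2 : ENNReal.ofReal (2 * c) ≤ e := by
    rw [← ENNReal.ofReal_coe_nnreal]; exact ENNReal.ofReal_le_ofReal hc
  refine lt_of_le_of_lt (timeChangeEDist_le l
    (uniformCost_le_of_logSlopeCost_le hc0.le hc1 hl.le) fun t => ?_) (h2.trans_lt heε)
  exact ((le_iSup (fun t => edist (x.toFun t) (y.toFun (l t))) t).trans hxy.le).trans
    (ENNReal.ofReal_le_ofReal (by linarith))

/-- The set of all values x(t) is totally bounded in 𝔻 by the real-valued case; this feeds the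
𝔻-valued case. The closure is taken in the complete space `CadlagMap D` and its compact image in
`DD`. -/
theorem DD.exists_isCompact {A : Set DD} {a : ℝ}
    (ha : ∀ x ∈ A, x.supNorm ≤ ENNReal.ofReal a)
    (hA1 : ∀ ε : ℝ≥0∞, 0 < ε → ∃ δ : ℝ, 0 < δ ∧ ∀ x ∈ A, ∀ t, modulus (x t) δ < ε)
    (hA2 : ∀ ε : ℝ≥0∞, 0 < ε → ∃ δ : ℝ, 0 < δ ∧ ∀ x ∈ A, modulus x δ < ε) :
    ∃ K, IsCompact K ∧ A ⊆ K := by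
  have hC : TotallyBounded {y : D | ∃ x ∈ A, ∃ t, y = x t} := by
    refine D.totallyBounded (a := a) ?_ fun ε hε => ?_
    · rintro _ ⟨x, hx, t, rfl⟩
      exact (le_iSup (fun t => (x t).supNorm) t).trans (ha x hx)
    · obtain ⟨δ, hδ, h⟩ := hA1 ε hε
      refine ⟨δ, hδ, ?_⟩
      rintro _ ⟨x, hx, t, rfl⟩
      exact h x hx t
  have hT : TotallyBounded (DD.ofCadlagMap ⁻¹' A) :=
    CadlagMap.totallyBounded hC (fun x hx t => ⟨DD.ofCadlagMap x, Set.mem_preimage.1 hx, t, rfl⟩) fun ε hε => by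
      obtain ⟨δ, hδ, h⟩ := hA2 ε hε
      exact ⟨δ, hδ, fun x hx => h (DD.ofCadlagMap x) (Set.mem_preimage.1 hx)⟩
  refine ⟨DD.ofCadlagMap '' closure (DD.ofCadlagMap ⁻¹' A),
    (isCompact_iff_totallyBounded_isComplete.2 ⟨hT.closure, isClosed_closure.isComplete⟩).image
      DD.continuous_ofCadlagMap, fun x hx => ?_⟩
  exact ⟨⟨x.toFun, x.cadlag⟩, subset_closure (Set.mem_preimage.2 hx), rfl⟩

/-! ### Tightness -/

section Tight

variable {P : ℕ → Measure DD}

theorem condNorm_of_isTight (h : IsTightMeasureSet (Set.range P)) : CondNorm P :=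
  DD.locallyVanishing_supNorm.tendsto_limsup h

theorem condSpaceModulus_of_isTight (h : IsTightMeasureSet (Set.range P)) : CondSpaceModulus P :=
  fun _ hε => (DD.locallyVanishing_spaceModulus hε).tendsto_limsup h

theorem condTimeModulus_of_isTight (h : IsTightMeasureSet (Set.range P)) : CondTimeModulus P :=
  fun _ hε => (DD.locallyVanishing_timeModulus hε).tendsto_limsup h

theorem CondNorm.condNormAt (h : CondNorm P) (T : Set I) : CondNormAt P T := fun t _ =>
  tendsto_of_tendsto_of_tendsto_of_le_of_le tendsto_const_nhds h (fun _ => zero_le) fun _ =>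
    limsup_le_limsup (Eventually.of_forall fun _ => measure_mono fun x hx =>
      le_trans hx (le_iSup (fun t => (x t).supNorm) t))

theorem isTight_of_cond (hP : ∀ n, IsProbabilityMeasure (P n)) (h1 : CondNorm P)
    (h2 : CondSpaceModulus P) (h3 : CondTimeModulus P) : IsTightMeasureSet (Set.range P) := by
  refine isTightMeasureSet_iff_exists_isCompact_measure_compl_le.2 fun η hη => ?_
  have hη3 : 0 < η / 3 := ENNReal.div_pos hη.ne' (by simp)
  -- `q k` is the probability allowed at modulus level 1/(k + 1); countable subadditivity of the
  -- outer measure avoids any measurability question.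
  obtain ⟨q, hq, hqη⟩ := ENNReal.exists_pos_sum_of_countable' hη3.ne' ℕ
  have he : ∀ k : ℕ, (0 : ℝ) < 1 / (k + 1) := fun k => Nat.one_div_pos_of_nat
  obtain ⟨a, ha⟩ := (DD.locallyVanishing_supNorm.eventually_forall_le hP h1 hη3).exists
  choose δ hδ hδ0 using fun k => (((DD.locallyVanishing_spaceModulus (he k)).eventually_forall_le
    hP (h2 _ (he k)) (hq k)).and self_mem_nhdsWithin).exists
  choose r hr hr0 using fun k => (((DD.locallyVanishing_timeModulus (he k)).eventually_forall_le
    hP (h3 _ (he k)) (hq k)).and self_mem_nhdsWithin).exists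
  let B1 : Set DD := {x | ENNReal.ofReal a ≤ x.supNorm}
  let B2 : ℕ → Set DD := fun k => {x | ∃ t, ENNReal.ofReal (1 / (k + 1)) ≤ modulus (x t) (δ k)}
  let B3 : ℕ → Set DD := fun k => {x | ENNReal.ofReal (1 / (k + 1)) ≤ modulus x (r k)}
  have hlim : Tendsto (fun k : ℕ => ENNReal.ofReal (1 / (k + 1))) atTop (𝓝 0) := by
    rw [← ENNReal.ofReal_zero]
    exact ENNReal.tendsto_ofReal tendsto_one_div_add_atTop_nhds_zero_nat
  obtain ⟨K, hK, hAK⟩ := DD.exists_isCompact (A := (B1 ∪ ((⋃ k, B2 k) ∪ ⋃ k, B3 k))ᶜ) (a := a)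
    (fun x hx => le_of_not_ge fun h => hx (Or.inl h))
    (fun ε hε => by
      obtain ⟨k, hk⟩ := (hlim.eventually (gt_mem_nhds hε)).exists
      refine ⟨δ k, hδ0 k, fun x hx t => lt_trans (not_le.1 fun h => hx ?_) hk⟩
      exact Or.inr (Or.inl (Set.mem_iUnion.2 ⟨k, t, h⟩)))
    (fun ε hε => by
      obtain ⟨k, hk⟩ := (hlim.eventually (gt_mem_nhds hε)).exists
      refine ⟨r k, hr0 k, fun x hx => lt_trans (not_le.1 fun h => hx ?_) hk⟩
      exact Or.inr (Or.inr (Set.mem_iUnion.2 ⟨k, h⟩)))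
  refine ⟨K, hK, ?_⟩
  rintro _ ⟨n, rfl⟩
  calc P n Kᶜ ≤ P n (B1 ∪ ((⋃ k, B2 k) ∪ ⋃ k, B3 k)) :=
        measure_mono (Set.compl_subset_comm.1 hAK)
    _ ≤ P n B1 + (P n (⋃ k, B2 k) + P n (⋃ k, B3 k)) :=
        (measure_union_le _ _).trans (add_le_add le_rfl (measure_union_le _ _))
    _ ≤ η / 3 + (η / 3 + η / 3) := by
        refine add_le_add (ha n) (add_le_add ?_ ?_)
        · exact (measure_iUnion_le _).trans ((ENNReal.tsum_le_tsum fun k => hδ k n).trans hqη.le)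
        · exact (measure_iUnion_le _).trans ((ENNReal.tsum_le_tsum fun k => hr k n).trans hqη.le)
    _ = η := by rw [← add_assoc, ENNReal.add_thirds]

/-! ### From bounds at the points of a dense set to a uniform bound -/

/-- Every subset of `[0,1]` which is dense has a finite subset meeting all intervals of a given
length. -/
theorem exists_finset_forall_mem_Ico {T : Set I} (hT : Dense T) {δ : ℝ} (hδ : 0 < δ) :
    ∃ R : Finset I, (R : Set I) ⊆ T ∧ ∀ a b : I, δ < (b : ℝ) - a → ∃ r ∈ R, r ∈ Set.Ico a b := by
  obtain ⟨R, hR⟩ := (isCompact_univ (X := I)).elim_finite_subcover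
    (fun r : T => Metric.ball (r : I) (δ / 2)) (fun _ => Metric.isOpen_ball) fun s _ => by
      obtain ⟨r, hr, hrT⟩ := Metric.dense_iff.1 hT s (δ / 2) (half_pos hδ)
      exact Set.mem_iUnion.2 ⟨⟨r, hrT⟩, Metric.mem_ball_comm.1 hr⟩
  classical
  refine ⟨R.image Subtype.val, by simp, fun a b hab => ?_⟩
  have a0 : (0 : ℝ) ≤ a := a.2.1
  have b1 : (b : ℝ) ≤ 1 := b.2.2
  -- A point within δ/2 of the midpoint lies in the interval, whose length exceeds δ.
  have := hR (Set.mem_univ (⟨(a + b) / 2, by linarith, by linarith⟩ : I))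
  simp only [Set.mem_iUnion] at this
  obtain ⟨r, hr, hd⟩ := this
  refine ⟨r, Finset.mem_image_of_mem _ hr, ?_⟩
  rw [Metric.mem_ball, Subtype.dist_eq, Real.dist_eq, abs_lt] at hd
  constructor
  · exact Subtype.coe_le_coe.1 (by linarith [hd.2])
  · exact Subtype.coe_lt_coe.1 (by linarith [hd.1])

/-- Each cell is longer than δ, hence contains some r in `R`, and x moves by less than 1 on it. The
time 1 is in no cell and must belong to `R`. Subtracting 2 rather than 1 keeps the final inequality
strict. -/
theorem DD.supNorm_lt_of_modulus_lt {x : DD} {δ a : ℝ} (hx : modulus x δ < 1) {R : Finset I}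
    (h1 : 1 ∈ R) (hR : ∀ a b : I, δ < (b : ℝ) - a → ∃ r ∈ R, r ∈ Set.Ico a b)
    (ha : ∀ r ∈ R, (x r).supNorm < ENNReal.ofReal (a - 2)) : x.supNorm < ENNReal.ofReal a := by
  obtain ⟨v, t, ht, ho⟩ := modulus_lt_iff.1 hx
  have ha2 : 0 < a - 2 := ENNReal.ofReal_pos.1 (bot_le.trans_lt (ha 1 h1))
  have hlt : ENNReal.ofReal (a - 2) + 1 < ENNReal.ofReal a := by
    rw [← ENNReal.ofReal_one, ← ENNReal.ofReal_add ha2.le zero_le_one]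
    exact (ENNReal.ofReal_lt_ofReal_iff (by linarith)).2 (by linarith)
  refine lt_of_le_of_lt (iSup_le fun s => ?_) hlt
  rcases eq_or_lt_of_le (show s ≤ 1 from s.2.2) with rfl | hs
  · exact (ha 1 h1).le.trans le_self_add
  · obtain ⟨i, hi⟩ := ht.exists_mem_Ico hs
    obtain ⟨r, hr, hri⟩ := hR _ _ (ht.gap i)
    refine (D.supNorm_le_add_edist _ _).trans (add_le_add (ha r hr).le ?_)
    exact (edist_le_osc hi hri).trans
      ((le_iSup (fun i : Fin v => osc x (Set.Ico (t i.castSucc) (t i.succ))) i).trans ho.le)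

theorem CondNormAt.condNorm {T : Set I} (hT : Dense T) (h1T : 1 ∈ T) (h : CondNormAt P T)
    (h3 : CondTimeModulus P) : CondNorm P := by
  classical
  refine ENNReal.tendsto_nhds_zero.2 fun η hη => ?_
  have hη2 : 0 < η / 2 := ENNReal.div_pos hη.ne' (by simp)
  obtain ⟨δ, hδ, hδ0 : 0 < δ⟩ := (((h3 1 one_pos).eventually (gt_mem_nhds hη2)).and
    self_mem_nhdsWithin).exists
  obtain ⟨R, hRT, hR⟩ := exists_finset_forall_mem_Ico hT hδ0
  let R' : Finset I := insert 1 R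
  -- Half of η pays for the modulus exceeding 1; the other half is shared equally among the points
  -- of `R'`.
  have hcard : 0 < η / 2 / R'.card := ENNReal.div_pos hη2.ne' (by simp)
  have hshift : Tendsto (fun a : ℝ => a - 2) atTop atTop :=
    tendsto_atTop_add_const_right _ (-2) tendsto_id
  have hall : ∀ᶠ a : ℝ in atTop, ∀ r ∈ R',
      limsup (fun n => P n {x | ENNReal.ofReal (a - 2) ≤ (x r).supNorm}) atTop
        < η / 2 / R'.card := by
    refine (eventually_all_finset _).2 fun r hr => ?_
    have hrT : r ∈ T := by
      rcases Finset.mem_insert.1 hr with rfl | hr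
      · exact h1T
      · exact hRT hr
    exact hshift.eventually ((h r hrT).eventually (gt_mem_nhds hcard))
  filter_upwards [hall] with a ha
  refine limsup_le_of_le (by isBoundedDefault) ?_
  filter_upwards [eventually_lt_of_limsup_lt hδ, (eventually_all_finset R').2 fun r hr =>
    eventually_lt_of_limsup_lt (ha r hr)] with n hn hn'
  calc P n {x | ENNReal.ofReal a ≤ x.supNorm}
      ≤ P n ({x | ENNReal.ofReal 1 ≤ modulus x δ} ∪
          ⋃ r ∈ R', {x | ENNReal.ofReal (a - 2) ≤ (x r).supNorm}) := by
        refine measure_mono fun x hx => ?_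
        by_contra hcon
        rw [Set.mem_union, not_or] at hcon
        refine absurd hx (not_le.2 (DD.supNorm_lt_of_modulus_lt (R := R') (δ := δ) ?_
          (Finset.mem_insert_self 1 R) ?_ fun r hr => not_le.1 fun h => hcon.2 ?_))
        · exact not_le.1 fun h => hcon.1 (ENNReal.ofReal_one.trans_le h)
        · intro a b hab
          obtain ⟨r, hr, hr'⟩ := hR a b hab
          exact ⟨r, Finset.mem_insert_of_mem hr, hr'⟩
        · exact Set.mem_iUnion₂.2 ⟨r, hr, h⟩
    _ ≤ η / 2 + ∑ r ∈ R', η / 2 / R'.card :=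
        (measure_union_le _ _).trans (add_le_add hn.le
          ((measure_biUnion_finset_le _ _).trans (Finset.sum_le_sum fun r hr => (hn' r hr).le)))
    _ ≤ η / 2 + η / 2 := by
        rw [Finset.sum_const, nsmul_eq_mul]
        exact add_le_add le_rfl ENNReal.mul_div_le
    _ = η := ENNReal.add_halves η

end Tight

end Skorokhod

theorem mainTheorem8 (P : ℕ → Measure Skorokhod.DD) (hP : ∀ n, IsProbabilityMeasure (P n))
    (T : Set unitInterval) (hT : Dense T) (h1T : 1 ∈ T) :
    (IsTightMeasureSet (Set.range P) ↔
      Skorokhod.CondNormAt P T ∧ Skorokhod.CondSpaceModulus P ∧ Skorokhod.CondTimeModulus P) ∧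
    (Skorokhod.CondNorm P ∧ Skorokhod.CondSpaceModulus P ∧ Skorokhod.CondTimeModulus P ↔
      Skorokhod.CondNormAt P T ∧ Skorokhod.CondSpaceModulus P ∧
        Skorokhod.CondTimeModulus P) := by
  refine ⟨⟨fun h => ⟨(Skorokhod.condNorm_of_isTight h).condNormAt T,
    Skorokhod.condSpaceModulus_of_isTight h, Skorokhod.condTimeModulus_of_isTight h⟩,
    fun ⟨h1, h2, h3⟩ => Skorokhod.isTight_of_cond hP (h1.condNorm hT h1T h3) h2 h3⟩,
    fun ⟨h1, h2, h3⟩ => ⟨h1.condNormAt T, h2, h3⟩,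
    fun ⟨h1, h2, h3⟩ => ⟨h1.condNorm hT h1T h3, h2, h3⟩⟩
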